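/- Let $m,n\ge 1$ be integers and let $K_n^m$ be the multigraph on $[n]=\{1,\dots,n\}$ with exactly $m$ edges between any two distinct vertices; its genus is $g=m\binom n2-n+1$. Let $\mathrm{Break}_{m,n}$ be the set of break divisors on $K_n^m$, i.e. of the $D\in\mathbb Z_{\ge0}^n$ with $\sum_i D_i=g$ and $\sum_{i\in S}D_i\ge m\binom{|S|}{2}-|S|+1$ (the genus of the subgraph induced on $S$) for every nonempty $S\subseteq[n]$. The symmetric group $S_n$ acts on it by permuting coordinates. Let $\mathcal D_{m,n}$ be the set of $(x_1,\dots,x_n)\in\{0,\dots,mn-1\}^n$ with $\sum_i x_i\equiv g \pmod{mn}$. Call two elements shift-equivalent if one is obtained from the other by repeatedly applying $(x_1,\dots,x_n)\mapsto(x_1+m,\dots,x_n+m)$, with addition modulo $mn$. Let $\widehat{\mathcal D}_{m,n}$ be the set of shift-equivalence classes, with the $S_n$-action induced by permuting coordinates. For a vertex $q\in[n]$ (for example $q=n$), let $\mathrm{Park}_{m,n}$ be the set of $K_n^m$-parking functions with respect to $q$, i.e. of the $f:[n]\setminus\{q\}\to\mathbb Z_{\ge0}$ such that every nonempty $S\subseteq[n]\setminus\{q\}$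 contains a vertex $v$ with $f(v)<m(n-|S|)$ (the number of edges from $v$ to vertices outside $S$). The group $S_{n-1}$ of permutations of $[n]\setminus\{q\}$ acts on it by permuting coordinates. Define numbers $\mathrm{DT}_k^{m+1}$, $k\ge1$, the numerical Donaldson–Thomas invariants of the $(m+1)$-loop quiver, as the unique rational numbers with $$\sum_{k\ge0}\frac{1}{mk+1}\binom{(m+1)k}{k}t^k=\prod_{k\ge1}\bigl(1-((-1)^mt)^k\bigr)^{-(-1)^{mk}\,k\,\mathrm{DT}_k^{m+1}}$$ as formal power series in $t$. Then the following hold. 1. $\mathrm{Break}_{m,n}$ and $\widehat{\mathcal D}_{m,n}$ are isomorphic as $S_n$-sets, and the associated complex permutation representations of $S_n$ are isomorphic. 2. The number of $S_n$-orbits satisfies $$|S_n\backslash\mathrm{Break}_{m,n}|=|S_n\backslash\widehat{\mathcal D}_{m,n}|=\mathrm{DT}_n^{m+1}=\frac1{n^2}\sum_{d\mid n}(-1)^{m(n+d)}\mu(n/d)\binom{(m+1)d-1}{md},$$ where $\mu$ is the Möbius function. 3. For every $q\in[n]$, the restriction of $\mathrm{Break}_{m,n}$ to the subgroup $S_{n-1}\subseteq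 S_n$ of permutations fixing $q$ is isomorphic to $\mathrm{Park}_{m,n}$ as an $S_{n-1}$-set, and the associated complex permutation representations of $S_{n-1}$ are isomorphic. -/

import Mathlib

/-! ### Multigraphs, break divisors and parking functions -/

/-- A loopless multigraph on the vertex set `V`: `mult s(u, v)` is the number of edges
joining `u` and `v`. -/
structure Multigraph (V : Type*) where
  mult : Sym2 V → ℕ
  loopless : ∀ e : Sym2 V, e.IsDiag → mult e = 0

namespace Multigraph

variable {V : Type*} [Fintype V] [DecidableEq V]

/-- The number of edges of the subgraph induced on `S`. -/
def edgesIn (G : Multigraph V) (S : Finset V) : ℕ := ∑ e ∈ S.sym2, G.mult e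

/-- `|E| - |V| + 1` for the subgraph induced on `S`. -/
def genusOn (G : Multigraph V) (S : Finset V) : ℤ := (G.edgesIn S : ℤ) - (S.card : ℤ) + 1

/-- The genus `|E(G)| - |V(G)| + 1`. -/
def genus (G : Multigraph V) : ℤ := G.genusOn Finset.univ

/-- The number of edges joining `v` to vertices outside `S`. -/
def outdeg (G : Multigraph V) (S : Finset V) (v : V) : ℕ := ∑ w ∈ Sᶜ, G.mult s(v, w)

/-- A break divisor: an effective divisor of degree the genus of `G` such that
`deg (D|_H) ≥ g(H)` for every (nonempty) induced subgraph `H`. -/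
structure IsBreakDivisor (G : Multigraph V) (D : V → ℤ) : Prop where
  effective : ∀ v, 0 ≤ D v
  degree : ∑ v, D v = G.genus
  induced : ∀ S : Finset V, S.Nonempty → G.genusOn S ≤ ∑ v ∈ S, D v

/-- A `q`-reduced divisor. -/
structure IsReduced (G : Multigraph V) (q : V) (D : V → ℤ) : Prop where
  nonneg : ∀ v, v ≠ q → 0 ≤ D v
  debt : ∀ S : Finset V, S.Nonempty → q ∉ S → ∃ v ∈ S, D v < (G.outdeg S v : ℤ)

/-- A `G`-parking function (with respect to `q`): the restriction of a `q`-reduced divisor to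
the vertices other than `q`. -/
def IsParkingFunction (G : Multigraph V) (q : V) (f : {v : V // v ≠ q} → ℤ) : Prop :=
  ∃ D : V → ℤ, G.IsReduced q D ∧ ∀ v : {v : V // v ≠ q}, f v = D v

/-- A permutation of the vertices preserving edge multiplicities. -/
def IsAut (G : Multigraph V) (σ : Equiv.Perm V) : Prop := ∀ e, G.mult (e.map σ) = G.mult e

variable {G : Multigraph V}

theorem IsAut.edgesIn_map {σ : Equiv.Perm V} (h : G.IsAut σ) (S : Finset V) :
    G.edgesIn (S.map σ.toEmbedding) = G.edgesIn S := by
  unfold edgesIn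
  rw [Finset.sym2_map, Finset.sum_map]
  exact Finset.sum_congr rfl fun e _ => h e

theorem IsAut.genusOn_map {σ : Equiv.Perm V} (h : G.IsAut σ) (S : Finset V) :
    G.genusOn (S.map σ.toEmbedding) = G.genusOn S := by
  simp [genusOn, h.edgesIn_map]

theorem IsAut.outdeg_map {σ : Equiv.Perm V} (h : G.IsAut σ) (S : Finset V) (v : V) :
    G.outdeg (S.map σ.toEmbedding) (σ v) = G.outdeg S v := by
  unfold outdeg
  have hS : (S.map σ.toEmbedding)ᶜ = (Sᶜ).map σ.toEmbedding := by
    ext x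
    simp [Finset.mem_map_equiv]
  rw [hS, Finset.sum_map]
  exact Finset.sum_congr rfl fun w _ => h s(v, w)

theorem IsBreakDivisor.comp_aut {D : V → ℤ} (hD : G.IsBreakDivisor D) {σ : Equiv.Perm V}
    (h : G.IsAut σ) : G.IsBreakDivisor (D ∘ σ) where
  effective v := hD.effective _
  degree := by rw [← hD.degree]; exact Equiv.sum_comp σ D
  induced S hS := by
    have := hD.induced (S.map σ.toEmbedding) (by simpa using hS)
    rw [h.genusOn_map, Finset.sum_map] at this
    exact this

theorem IsReduced.comp_aut {q : V} {D : V → ℤ} (hD : G.IsReduced q D) {σ : Equiv.Perm V}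
    (h : G.IsAut σ) (hq : σ q = q) : G.IsReduced q (D ∘ σ) where
  nonneg v hv := hD.nonneg _ fun hv' => hv (σ.injective (hv'.trans hq.symm))
  debt S hS hqS := by
    obtain ⟨w, hw, hlt⟩ := hD.debt (S.map σ.toEmbedding) (by simpa using hS) (by
      intro hmem
      obtain ⟨x, hx, hxq⟩ := Finset.mem_map.1 hmem
      have : x = q := σ.injective (hxq.trans hq.symm)
      exact hqS (this ▸ hx))
    obtain ⟨x, hx, rfl⟩ := Finset.mem_map.1 hw
    refine ⟨x, hx, ?_⟩
    have hout := h.outdeg_map S x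
    change D (σ x) < _ at hlt
    change D (σ x) < _
    rw [← hout]
    exact hlt

theorem IsParkingFunction.comp_perm {q : V} {f : {v : V // v ≠ q} → ℤ}
    (hf : G.IsParkingFunction q f) (τ : Equiv.Perm {v : V // v ≠ q})
    (h : G.IsAut (Equiv.Perm.ofSubtype τ)) : G.IsParkingFunction q (f ∘ τ) := by
  obtain ⟨D, hD, hfD⟩ := hf
  refine ⟨D ∘ Equiv.Perm.ofSubtype τ, hD.comp_aut h ?_, fun v => ?_⟩
  · exact Equiv.Perm.ofSubtype_apply_of_not_mem τ (by simp)
  · simp [hfD]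

end Multigraph

/-- The complete multigraph `K_n^m`: `m` edges between any two distinct vertices of an
`n`-element vertex set. -/
def completeMultigraph (m n : ℕ) : Multigraph (Fin n) where
  mult e := if e.IsDiag then 0 else m
  loopless _ he := if_pos he

theorem completeMultigraph_isAut (m n : ℕ) (σ : Equiv.Perm (Fin n)) :
    (completeMultigraph m n).IsAut σ := by
  intro e
  have : (e.map σ).IsDiag ↔ e.IsDiag := Sym2.isDiag_map σ.injective
  simp only [completeMultigraph, this]

/-- The set of break divisors on `K_n^m`. -/
def BreakDiv (m n : ℕ) : Type :=
  {D : Fin n → ℤ // (completeMultigraph m n).IsBreakDivisor D}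

/-- `S_n` permutes the coordinates of a break divisor. -/
instance (m n : ℕ) : MulAction (Equiv.Perm (Fin n)) (BreakDiv m n) where
  smul σ D := ⟨fun i => D.1 (σ⁻¹ i), D.2.comp_aut (completeMultigraph_isAut m n σ⁻¹)⟩
  one_smul _ := rfl
  mul_smul _ _ _ := rfl

/-- The set of `K_n^m`-parking functions, with respect to the vertex `q`. -/
def Park (m n : ℕ) (q : Fin n) : Type :=
  {f : {v : Fin n // v ≠ q} → ℤ // (completeMultigraph m n).IsParkingFunction q f}

/-- The symmetric group on the `n - 1` vertices other than `q` permutes the coordinates of a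
parking function. -/
instance (m n : ℕ) (q : Fin n) : MulAction (Equiv.Perm {v : Fin n // v ≠ q}) (Park m n q) where
  smul τ f := ⟨fun v => f.1 (τ⁻¹ v), f.2.comp_perm τ⁻¹ (completeMultigraph_isAut m n _)⟩
  one_smul _ := rfl
  mul_smul _ _ _ := rfl

/-! ### Sequences modulo `N = mn` and their shift classes -/

/-- The set of `n`-tuples with entries in `{0, …, mn - 1}` (residues modulo `mn`) whose sum is
congruent to the genus of `K_n^m` modulo `mn`. -/
def DSeq (m n : ℕ) : Type :=
  {x : Fin n → ZMod (m * n) // ∑ i, x i = ((completeMultigraph m n).genus : ZMod (m * n))}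

/-- `S_n` permutes the coordinates. -/
instance (m n : ℕ) : MulAction (Equiv.Perm (Fin n)) (DSeq m n) where
  smul σ x := ⟨fun i => x.1 (σ⁻¹ i), (Equiv.sum_comp σ⁻¹ x.1).trans x.2⟩
  one_smul _ := rfl
  mul_smul _ _ _ := rfl

/-- The shift map: add `m` to every coordinate, modulo `mn`. -/
def DSeq.shift {m n : ℕ} (x : DSeq m n) : DSeq m n :=
  ⟨fun i => x.1 i + (m : ZMod (m * n)), by
    have h : (n : ZMod (m * n)) * (m : ZMod (m * n)) = 0 := by
      rw [mul_comm, ← Nat.cast_mul, ZMod.natCast_self]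
    simp [Finset.sum_add_distrib, x.2, h]⟩

theorem DSeq.shift_iterate_val {m n : ℕ} (j : ℕ) (x : DSeq m n) (i : Fin n) :
    (DSeq.shift^[j] x).1 i = x.1 i + ((m * j : ℕ) : ZMod (m * n)) := by
  induction j with
  | zero => simp
  | succ j ih =>
    rw [Function.iterate_succ_apply']
    change (DSeq.shift^[j] x).1 i + (m : ZMod (m * n)) = _
    rw [ih]
    push_cast
    ring

theorem DSeq.shift_iterate_smul {m n : ℕ} (j : ℕ) (σ : Equiv.Perm (Fin n)) (x : DSeq m n) :
    DSeq.shift^[j] (σ • x) = σ • DSeq.shift^[j] x := by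
  refine Subtype.ext (funext fun i => ?_)
  change _ = (DSeq.shift^[j] x).1 (σ⁻¹ i)
  rw [shift_iterate_val, shift_iterate_val]
  rfl

/-- Shift-equivalence: `y` is obtained from `x` by applying a power of the shift. -/
def shiftSetoid (m n : ℕ) : Setoid (DSeq m n) where
  r x y := ∃ j : ℕ, DSeq.shift^[j] x = y
  iseqv :=
    { refl := fun x => ⟨0, rfl⟩
      symm := by
        rintro x _ ⟨j, rfl⟩
        refine ⟨n * j - j, Subtype.ext (funext fun i => ?_)⟩
        have hn : 1 ≤ n := Nat.one_le_of_lt i.2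
        have hle : j ≤ n * j := Nat.le_mul_of_pos_left j hn
        rw [DSeq.shift_iterate_val, DSeq.shift_iterate_val, add_assoc, ← Nat.cast_add,
          ← Nat.mul_add, Nat.add_sub_cancel' hle, ← Nat.mul_assoc, Nat.cast_mul,
          ZMod.natCast_self, zero_mul, add_zero]
      trans := by
        rintro x _ _ ⟨j, rfl⟩ ⟨k, rfl⟩
        exact ⟨k + j, Function.iterate_add_apply _ _ _ _⟩ }

/-- The set of shift-equivalence classes. -/
def DHat (m n : ℕ) : Type := Quotient (shiftSetoid m n)

/-- The induced action of `S_n` on shift-equivalence classes. -/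
instance (m n : ℕ) : MulAction (Equiv.Perm (Fin n)) (DHat m n) where
  smul σ := Quotient.map (fun x : DSeq m n => σ • x) (by
    rintro x _ ⟨j, rfl⟩
    exact ⟨j, DSeq.shift_iterate_smul j σ x⟩)
  one_smul c := by
    induction c using Quotient.inductionOn
    rfl
  mul_smul σ τ c := by
    induction c using Quotient.inductionOn
    rfl

/-! ### Numerical Donaldson-Thomas invariants of the `(m+1)`-loop quiver -/

/-- The generating series `∑ 1/(mn+1) * binom((m+1)n, n) t^n` of `(m+1)`-ary trees. -/
noncomputable def treeSeries (m : ℕ) : PowerSeries ℚ :=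
  PowerSeries.mk fun n => (1 / ((m : ℚ) * n + 1)) * (((m + 1) * n).choose n : ℚ)

/-- The formal power series `(1 + u)^r`, for `u` without constant term. -/
noncomputable def onePlusPow (u : PowerSeries ℚ) (r : ℚ) : PowerSeries ℚ :=
  (PowerSeries.binomialSeries ℚ r).subst u

/-- The Euler factor `(1 - ((-1)^m t)^k)^(-(-1)^(mk) * k * c)`. -/
noncomputable def eulerFactor (m k : ℕ) (c : ℚ) : PowerSeries ℚ :=
  onePlusPow (-(((-1) ^ m * PowerSeries.X) ^ k)) (-((-1) ^ (m * k) * (k : ℚ) * c))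

/-- `a 1, a 2, …` are the exponents in the Euler product
`F(t) = ∏_{k ≥ 1} (1 - ((-1)^m t)^k)^(-(-1)^(mk) * k * a k)`, where `F` is the tree series.
The product is `t`-adic: its `k`-th factor is `1` modulo `t^k`, so the coefficient of `t^N`
is that of any partial product over `1 ≤ k ≤ K` with `K ≥ N`. -/
def IsDTSequence (m : ℕ) (a : ℕ → ℚ) : Prop :=
  ∀ N K : ℕ, N ≤ K →
    PowerSeries.coeff N (∏ k ∈ Finset.Icc 1 K, eulerFactor m k (a k)) =
      PowerSeries.coeff N (treeSeries m)

theorem eulerFactor_eq (m k : ℕ) (hk : k ≠ 0) (c : ℚ) :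
    ∃ Q : PowerSeries ℚ, eulerFactor m k c = 1 + PowerSeries.X ^ k * Q ∧
      PowerSeries.coeff 0 Q = k * c := by
  set r : ℚ := -((-1) ^ (m * k) * (k : ℚ) * c) with hr
  set u : PowerSeries ℚ := -(((-1) ^ m * PowerSeries.X) ^ k) with hu
  have hu' : u = PowerSeries.X ^ k * (-((-1) ^ m) ^ k) := by rw [hu]; ring
  have hsub : PowerSeries.HasSubst u := by
    apply PowerSeries.HasSubst.of_constantCoeff_zero'
    rw [hu']
    simp [hk]
  obtain ⟨R, hR⟩ : ∃ R : PowerSeries ℚ, PowerSeries.binomialSeries ℚ r =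
      1 + PowerSeries.X * (PowerSeries.C r + PowerSeries.X * R) := by
    refine ⟨PowerSeries.mk fun n => Ring.choose r (n + 2), PowerSeries.ext fun n => ?_⟩
    rcases n with _ | _ | n
    · simp
    · rw [PowerSeries.binomialSeries_coeff, map_add, PowerSeries.coeff_succ_X_mul]
      simp [PowerSeries.coeff_one]
    · rw [PowerSeries.binomialSeries_coeff, map_add, PowerSeries.coeff_succ_X_mul, map_add,
        PowerSeries.coeff_succ_X_mul]
      simp [PowerSeries.coeff_one]
  refine ⟨(-((-1) ^ m) ^ k) * (PowerSeries.C r + u * R.subst u), ?_, ?_⟩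
  · have key : PowerSeries.substAlgHom (R := ℚ) hsub (PowerSeries.binomialSeries ℚ r) =
        1 + u * (PowerSeries.C r + u * R.subst u) := by
      rw [hR, map_add, map_mul, map_add, map_mul, map_one, PowerSeries.substAlgHom_X,
        PowerSeries.coe_substAlgHom, PowerSeries.subst_C]
      rfl
    rw [PowerSeries.coe_substAlgHom] at key
    change (PowerSeries.binomialSeries ℚ r).subst u = _
    rw [key]
    nth_rewrite 1 [hu']
    ring
  · have h0 : PowerSeries.constantCoeff u = 0 := by
      rw [hu']
      simp [hk]
    have hs : ((-1 : ℚ) ^ (m * k)) * (-1) ^ (m * k) = 1 := by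
      rw [← mul_pow]; simp
    simp only [PowerSeries.coeff_zero_eq_constantCoeff, map_mul, map_neg, map_pow, map_one,
      map_add, h0, PowerSeries.constantCoeff_C, zero_mul, add_zero, ← pow_mul, hr]
    linear_combination (k * c) * hs

theorem eulerProd_coeff_zero (m K : ℕ) (a : ℕ → ℚ) :
    PowerSeries.coeff 0 (∏ k ∈ Finset.Icc 1 K, eulerFactor m k (a k)) = 1 := by
  rw [PowerSeries.coeff_zero_eq_constantCoeff, map_prod]
  refine Finset.prod_eq_one fun k hk => ?_
  have hk0 : k ≠ 0 := by have := (Finset.mem_Icc.1 hk).1; omega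
  obtain ⟨Q, hQ, -⟩ := eulerFactor_eq m k hk0 (a k)
  simp [hQ, hk0]

theorem eulerProd_coeff_of_le (m : ℕ) (a : ℕ → ℚ) {N K : ℕ} (h : N ≤ K) :
    PowerSeries.coeff N (∏ k ∈ Finset.Icc 1 K, eulerFactor m k (a k)) =
      PowerSeries.coeff N (∏ k ∈ Finset.Icc 1 N, eulerFactor m k (a k)) := by
  induction K, h using Nat.le_induction with
  | base => rfl
  | succ K hK ih =>
    obtain ⟨Q, hQ, -⟩ := eulerFactor_eq m (K + 1) (Nat.succ_ne_zero K) (a (K + 1))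
    rw [Finset.prod_Icc_succ_top (by omega), hQ, mul_add, mul_one, map_add, ih,
      mul_left_comm, PowerSeries.coeff_X_pow_mul', if_neg (by omega), add_zero]

theorem eulerProd_coeff_succ (m : ℕ) (a : ℕ → ℚ) (K : ℕ) :
    PowerSeries.coeff (K + 1) (∏ k ∈ Finset.Icc 1 (K + 1), eulerFactor m k (a k)) =
      PowerSeries.coeff (K + 1) (∏ k ∈ Finset.Icc 1 K, eulerFactor m k (a k))
        + ((K + 1 : ℕ) : ℚ) * a (K + 1) := by
  obtain ⟨Q, hQ, hQ0⟩ := eulerFactor_eq m (K + 1) (Nat.succ_ne_zero K) (a (K + 1))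
  rw [Finset.prod_Icc_succ_top (by omega), hQ, mul_add, mul_one, map_add,
    mul_left_comm, PowerSeries.coeff_X_pow_mul', if_pos le_rfl, Nat.sub_self,
    PowerSeries.coeff_zero_eq_constantCoeff, map_mul,
    ← PowerSeries.coeff_zero_eq_constantCoeff_apply,
    ← PowerSeries.coeff_zero_eq_constantCoeff_apply, eulerProd_coeff_zero, hQ0, one_mul]

/-- Partial products and exponents of the Euler product, constructed one factor at a time. -/
noncomputable def eulerStep (m : ℕ) : ℕ → PowerSeries ℚ × ℚ
  | 0 => (1, 0)
  | K + 1 =>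
    let c : ℚ := (PowerSeries.coeff (K + 1) (treeSeries m)
      - PowerSeries.coeff (K + 1) (eulerStep m K).1) / ((K + 1 : ℕ) : ℚ)
    ((eulerStep m K).1 * eulerFactor m (K + 1) c, c)

theorem eulerStep_fst (m K : ℕ) :
    (eulerStep m K).1 = ∏ k ∈ Finset.Icc 1 K, eulerFactor m k (eulerStep m k).2 := by
  induction K with
  | zero => simp [eulerStep]
  | succ K ih =>
    rw [Finset.prod_Icc_succ_top (by omega), ← ih]
    rfl

theorem exists_isDTSequence (m : ℕ) : ∃ a : ℕ → ℚ, IsDTSequence m a := by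
  refine ⟨fun k => (eulerStep m k).2, fun N K h => ?_⟩
  rw [eulerProd_coeff_of_le m _ h]
  rcases N with _ | N
  · rw [eulerProd_coeff_zero]
    simp [treeSeries]
  · rw [eulerProd_coeff_succ, ← eulerStep_fst]
    have : ((N + 1 : ℕ) : ℚ) ≠ 0 := by positivity
    simp only [eulerStep]
    field_simp
    ring

/-- The Euler product determines the exponents. -/
theorem IsDTSequence.unique {m : ℕ} {a b : ℕ → ℚ} (ha : IsDTSequence m a)
    (hb : IsDTSequence m b) (n : ℕ) (hn : 0 < n) : a n = b n := by
  induction n using Nat.strong_induction_on with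
  | _ n ih =>
    obtain ⟨K, rfl⟩ : ∃ K, n = K + 1 := ⟨n - 1, by omega⟩
    have h := (ha (K + 1) (K + 1) le_rfl).trans (hb (K + 1) (K + 1) le_rfl).symm
    have hprod : ∏ k ∈ Finset.Icc 1 K, eulerFactor m k (a k) =
        ∏ k ∈ Finset.Icc 1 K, eulerFactor m k (b k) :=
      Finset.prod_congr rfl fun k hk => by
        have := Finset.mem_Icc.1 hk
        rw [ih k (by omega) (by omega)]
    rw [eulerProd_coeff_succ, eulerProd_coeff_succ, hprod] at h
    have h0 : ((K + 1 : ℕ) : ℚ) ≠ 0 := by positivity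
    exact mul_left_cancel₀ h0 (add_left_cancel h)

/-- The numerical Donaldson-Thomas invariant `DT_n^{m+1}` of the `(m+1)`-loop quiver, for
`n ≥ 1`: the exponents in the Euler product of the tree series. -/
noncomputable def loopQuiverDT (m : ℕ) : ℕ → ℚ := (exists_isDTSequence m).choose

theorem loopQuiverDT_spec (m : ℕ) : IsDTSequence m (loopQuiverDT m) :=
  (exists_isDTSequence m).choose_spec

/-! ### Linear equivalence of divisors on `K_n^m` -/

/-! Break divisors, shift classes and parking functions are three descriptions of the divisor
classes of degree `g` on `K_n^m`. The Laplacian sends `a` to `m * (n * a i - ∑ j, a j)`, so modulo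
`mn` a linear equivalence only adds a common multiple of `m` to all coordinates; in fixed degree `g`
the converse also holds (`DHat.ofDivisor_eq_iff`). Each class of degree `g` contains exactly one
break divisor and exactly one `q`-reduced divisor, the latter being determined by its values off
`q`. The resulting bijections `BreakDiv.toDHat` and `Park.toDHat` are equivariant, which gives both
isomorphisms of sets with group action, hence of representations.

For the orbit count, the shift generates a group of order `n` acting freely on the `S_n`-orbits of
sequences (`DSeq.dvd_of_shift_eq_smul`), so these are `n` times as many as the orbits of shift
classes. They are the multisets of `n` residues modulo `mn` with sum `g`. A roots-of-unity filter
counts them: a root of order `k` contributes only if `k ∣ n`, and summing over the primitive roots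
of order `k` produces `μ(k)`.

For the Donaldson–Thomas side, take logarithmic derivatives. That of the tree series has
coefficients `binom((m+1)i-1, mi)` (`X_mul_derivative_treeSeries`, from a Rothe–Hagen convolution),
and that of an Euler factor is a geometric series. Comparing coefficients gives a divisor sum, which
Möbius inversion solves by `dtFormula`; the exponents being unique, this is the invariant. -/

theorem completeMultigraph_genusOn (m n : ℕ) (S : Finset (Fin n)) :
    (completeMultigraph m n).genusOn S = m * (S.card.choose 2 : ℕ) - S.card + 1 := by
  have h : (completeMultigraph m n).edgesIn S = m * S.card.choose 2 := by
    unfold Multigraph.edgesIn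
    induction S using Finset.induction_on with
    | empty => simp
    | insert a S ha ih =>
      rw [Finset.sym2_insert, Finset.sum_union, ih, Finset.card_insert_of_notMem ha,
        Nat.choose_succ_succ' S.card 1, Nat.choose_one_right, mul_add,
        Finset.sum_image fun x _ y _ h => Sym2.congr_right.1 h, Finset.sum_insert ha]
      · congr 1
        rw [Finset.sum_congr rfl (g := fun _ => m)]
        · simp [completeMultigraph, mul_comm]
        · intro x hx
          have : a ≠ x := fun h => ha (h ▸ hx)
          simp [completeMultigraph, this]
      · rw [Finset.disjoint_left]
        intro e he he'
        obtain ⟨x, -, rfl⟩ := Finset.mem_image.1 he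
        exact ha (Finset.mk_mem_sym2_iff.1 he').1
  simp [Multigraph.genusOn, h]

theorem two_mul_genusOn (m n : ℕ) (S : Finset (Fin n)) :
    2 * (completeMultigraph m n).genusOn S =
      m * (S.card * (S.card - 1)) - 2 * S.card + 2 := by
  rw [completeMultigraph_genusOn]
  have h : ((S.card.choose 2 : ℕ) : ℚ) = S.card * (S.card - 1) / 2 := Nat.cast_choose_two ℚ _
  have h' : 2 * ((S.card.choose 2 : ℕ) : ℤ) = S.card * (S.card - 1) := by
    have : (2 * ((S.card.choose 2 : ℕ) : ℚ)) = S.card * (S.card - 1) := by rw [h]; ring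
    exact_mod_cast this
  linear_combination (m : ℤ) * h'

theorem two_mul_genus (m n : ℕ) :
    2 * (completeMultigraph m n).genus = m * (n * (n - 1)) - 2 * n + 2 := by
  simpa [Multigraph.genus] using two_mul_genusOn m n Finset.univ

theorem completeMultigraph_outdeg {m n : ℕ} {S : Finset (Fin n)} {v : Fin n} (hv : v ∈ S) :
    ((completeMultigraph m n).outdeg S v : ℤ) = m * (n - S.card) := by
  have : (completeMultigraph m n).outdeg S v = m * Sᶜ.card := by
    unfold Multigraph.outdeg
    rw [Finset.sum_congr rfl (g := fun _ => m)]
    · simp [mul_comm]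
    · intro w hw
      have : v ≠ w := fun h => (Finset.mem_compl.1 hw) (h ▸ hv)
      simp [completeMultigraph, this]
  have hc : ((Sᶜ.card : ℕ) : ℤ) = n - S.card := by
    have := Finset.card_add_card_compl S
    rw [Fintype.card_fin] at this
    omega
  rw [this]
  push_cast
  rw [hc]

/-- Linear equivalence of divisors on `K_n^m`: the difference is in the image of the Laplacian. -/
def LinEquiv (m n : ℕ) (D D' : Fin n → ℤ) : Prop :=
  ∃ a : Fin n → ℤ, ∀ i, D' i = D i + m * (n * a i - ∑ j, a j)

namespace LinEquiv

variable {m n : ℕ} {D D' D'' : Fin n → ℤ}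

theorem refl (D : Fin n → ℤ) : LinEquiv m n D D := ⟨0, fun i => by simp⟩

theorem symm (h : LinEquiv m n D D') : LinEquiv m n D' D := by
  obtain ⟨a, ha⟩ := h
  exact ⟨-a, fun i => by simp [ha]; ring⟩

theorem trans (h : LinEquiv m n D D') (h' : LinEquiv m n D' D'') : LinEquiv m n D D'' := by
  obtain ⟨a, ha⟩ := h
  obtain ⟨b, hb⟩ := h'
  exact ⟨a + b, fun i => by simp [hb, ha, Finset.sum_add_distrib]; ring⟩

theorem sum_eq (h : LinEquiv m n D D') : ∑ i, D' i = ∑ i, D i := by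
  obtain ⟨a, ha⟩ := h
  simp [ha, Finset.sum_add_distrib, ← Finset.mul_sum]

/-- Firing a set of vertices. -/
theorem fire (D : Fin n → ℤ) (S : Finset (Fin n)) :
    LinEquiv m n D fun i => D i + m * (n * (if i ∈ S then 1 else 0) - S.card) :=
  ⟨fun i => if i ∈ S then 1 else 0, fun i => by simp⟩

end LinEquiv

section

variable {m n : ℕ}

/-! ### Break divisors: exactly one in each class of degree `g` -/

theorem eq_of_forall_le {D D' a : Fin n → ℤ}
    (ha : ∀ i, D' i = D i + m * (n * a i - ∑ j, a j)) (h : ∀ i j, a i ≤ a j) : D' = D := by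
  funext i
  have : ∑ j, a j = n * a i := by
    rw [Finset.sum_congr rfl fun j _ => le_antisymm (h j i) (h i j)]
    simp
  rw [ha, this]
  ring

/-- The set where `a` is minimal loses at least its number of outgoing edges. -/
theorem sum_ge_of_isMin (a : Fin n → ℤ) (i : Fin n) (hi : ∀ j, a i ≤ a j) :
    n * a i + (n - (Finset.univ.filter fun j => a j = a i).card) ≤ ∑ j, a j := by
  have h : ∀ j, a i + (1 - if a j = a i then 1 else 0) ≤ a j := by
    intro j
    have := hi j
    split_ifs <;> omega
  have := Finset.sum_le_sum fun j (_ : j ∈ Finset.univ) => h j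
  simpa [Finset.sum_add_distrib] using this

/-- Passing from `D` to `D'`, the set `S` where `a` is minimal loses at least `m|S||Sᶜ|`, the number
of edges leaving it. As `D'` still has degree at least `g(S)` on `S`, and `D` has at least `g(Sᶜ)`
on the complement, `deg D ≥ g(S) + g(Sᶜ) + m|S||Sᶜ| = g + 1`, which is absurd. So `a` is constant.
-/
theorem isBreakDivisor_unique {D D' : Fin n → ℤ}
    (hD : (completeMultigraph m n).IsBreakDivisor D)
    (hD' : (completeMultigraph m n).IsBreakDivisor D') (h : LinEquiv m n D D') : D' = D := by
  obtain ⟨a, ha⟩ := h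
  by_cases hc : ∀ i j, a i ≤ a j
  · exact eq_of_forall_le ha hc
  exfalso
  push Not at hc
  obtain ⟨i₀, j₀, hij⟩ := hc
  have : Nonempty (Fin n) := ⟨i₀⟩
  obtain ⟨i, hi⟩ := Finite.exists_min a
  set S := Finset.univ.filter fun j => a j = a i with hS
  have hiS : i ∈ S := by simp [hS]
  have hi₀ : i₀ ∈ Sᶜ := by
    simp only [hS, Finset.mem_compl, Finset.mem_filter, Finset.mem_univ, true_and]
    have := hi j₀
    omega
  have h1 := hD'.induced S ⟨i, hiS⟩
  have h2 := hD.induced Sᶜ ⟨i₀, hi₀⟩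
  have h3 := hD.degree
  rw [← Finset.sum_add_sum_compl S] at h3
  have h4 : ∑ v ∈ S, D' v = ∑ v ∈ S, D v + S.card * (m * (n * a i - ∑ j, a j)) := by
    rw [Finset.sum_congr rfl (g := fun v => D v + m * (n * a i - ∑ j, a j))]
    · simp [Finset.sum_add_distrib]
    · intro v hv
      rw [ha, (Finset.mem_filter.1 hv).2]
  have h5 := sum_ge_of_isMin a i hi
  rw [← hS] at h5
  have g1 := two_mul_genusOn m n S
  have g2 := two_mul_genusOn m n Sᶜ
  have g3 := two_mul_genus m n
  have hc : ((Sᶜ.card : ℕ) : ℤ) = n - S.card := by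
    have := Finset.card_add_card_compl S
    rw [Fintype.card_fin] at this
    omega
  rw [hc] at g2
  have h6 : (S.card : ℤ) * (m * (n * a i - ∑ j, a j)) ≤ S.card * (m * -(n - S.card)) := by
    gcongr
    linarith
  nlinarith

theorem exists_forall_le_of_nonneg {α : Type*} {p : α → Prop} (f : α → ℤ)
    (hf : ∀ x, p x → 0 ≤ f x) (h : ∃ x, p x) : ∃ x, p x ∧ ∀ y, p y → f x ≤ f y := by
  refine ⟨Function.argminOn (fun x => (f x).toNat) {x | p x} h,
    Function.argminOn_mem _ {x | p x} h, fun y hy => ?_⟩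
  have h1 := Function.argminOn_le (fun x => (f x).toNat) {x | p x} hy
  have h2 := hf _ hy
  have h3 : (f (Function.argminOn (fun x => (f x).toNat) {x | p x} h)).toNat ≤ (f y).toNat := h1
  omega

/-- A divisor of minimal Euclidean norm in its class is a break divisor. -/
theorem exists_isBreakDivisor (hm : 0 < m) (hn : 0 < n) {D : Fin n → ℤ}
    (hD : ∑ i, D i = (completeMultigraph m n).genus) :
    ∃ D', (completeMultigraph m n).IsBreakDivisor D' ∧ LinEquiv m n D D' := by
  obtain ⟨E, hE, hmin⟩ := exists_forall_le_of_nonneg (p := LinEquiv m n D)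
    (fun E => ∑ i, E i ^ 2) (fun E _ => Finset.sum_nonneg fun i _ => sq_nonneg _) ⟨D, .refl D⟩
  have hdeg : ∑ i, E i = (completeMultigraph m n).genus := hE.sum_eq.trans hD
  have key : ∀ S : Finset (Fin n), S.Nonempty →
      (completeMultigraph m n).genusOn S ≤ ∑ v ∈ S, E v := by
    intro S hS
    -- Norm minimality is only needed against the move that adds `m(n-|S|)` on `S` and subtracts
    -- `m|S|` elsewhere.
    have h := hmin _ (hE.trans (.fire E S))
    have e1 : ∀ i, (E i + m * (n * (if i ∈ S then 1 else 0) - S.card : ℤ)) ^ 2 =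
        E i ^ 2 + (2 * m * n * (if i ∈ S then E i else 0) - 2 * m * S.card * E i) +
          m ^ 2 * ((n ^ 2 - 2 * n * S.card) * (if i ∈ S then 1 else 0) + (S.card : ℤ) ^ 2) := by
      intro i
      split_ifs <;> ring
    simp only [e1, Finset.sum_add_distrib, Finset.sum_sub_distrib, ← Finset.mul_sum, hdeg,
      Finset.sum_ite_mem, Finset.univ_inter, Finset.sum_const, Finset.card_univ,
      Fintype.card_fin, nsmul_eq_mul] at h
    have g1 := two_mul_genusOn m n S
    have g3 := two_mul_genus m n
    have hs : (0 : ℤ) < S.card := by exact_mod_cast hS.card_pos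
    have hm' : (0 : ℤ) < m := by exact_mod_cast hm
    have hn' : (0 : ℤ) < n := by exact_mod_cast hn
    have h1 : 0 ≤ (m : ℤ) * (2 * n * ∑ v ∈ S, E v - S.card * (2 * (completeMultigraph m n).genus)
        + m * n * S.card * (n - S.card)) := by
      linarith
    have h2 := nonneg_of_mul_nonneg_right h1 hm'
    rw [g3] at h2
    -- The quantity is at least `2|S| > 0`; strictness with integrality turns `E(S) > g(S) - 1` into
    -- the bound sought.
    have h3 : 0 < (n : ℤ) * (2 * ∑ v ∈ S, E v - (2 * (completeMultigraph m n).genusOn S - 2)) := by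
      rw [g1]
      linarith
    have h4 := pos_of_mul_pos_right h3 hn'.le
    omega
  refine ⟨E, ⟨fun v => ?_, hdeg, key⟩, hE⟩
  -- A single vertex has genus `0`, so the inequality for singletons is effectiveness.
  have := key {v} ⟨v, by simp⟩
  have g1 := two_mul_genusOn m n {v}
  simp at this g1
  omega

/-! ### Reduced divisors: exactly one in each class -/

theorem isReduced_le {q : Fin n} {D D' a : Fin n → ℤ}
    (hD : (completeMultigraph m n).IsReduced q D) (hD' : (completeMultigraph m n).IsReduced q D')
    (ha : ∀ i, D' i = D i + m * (n * a i - ∑ j, a j)) (j : Fin n) : a q ≤ a j := by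
  have : Nonempty (Fin n) := ⟨q⟩
  obtain ⟨i, hi⟩ := Finite.exists_min a
  by_cases hq : a q = a i
  · exact hq ▸ hi j
  exfalso
  set S := Finset.univ.filter fun j => a j = a i with hS
  have hqS : q ∉ S := by simp [hS, hq]
  -- If the minimal set of `a` avoided `q`, each of its vertices would lose at least its outdegree,
  -- and this `v` would fall into debt in `D'`.
  obtain ⟨v, hv, hlt⟩ := hD.debt S ⟨i, by simp [hS]⟩ hqS
  rw [completeMultigraph_outdeg hv] at hlt
  have h1 := hD'.nonneg v fun h => hqS (h ▸ hv)
  have h5 := sum_ge_of_isMin a i hi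
  rw [← hS] at h5
  rw [ha, (Finset.mem_filter.1 hv).2] at h1
  have h6 : (m : ℤ) * (n * a i - ∑ j, a j) ≤ m * -(n - S.card) := by
    gcongr
    linarith
  linarith

theorem isReduced_unique {q : Fin n} {D D' : Fin n → ℤ}
    (hD : (completeMultigraph m n).IsReduced q D) (hD' : (completeMultigraph m n).IsReduced q D')
    (h : LinEquiv m n D D') : D' = D := by
  obtain ⟨a, ha⟩ := h
  have h1 := isReduced_le hD hD' ha
  -- By symmetry `q` is also a maximum of `a`, so `a` is constant.
  have h2 := isReduced_le (a := -a) hD' hD fun i => by simp [ha]; ring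
  have h3 : ∀ j, a j = a q := fun j => le_antisymm (by simpa using h2 j) (h1 j)
  exact eq_of_forall_le ha fun i j => by rw [h3, h3 j]

theorem exists_isReduced (hm : 0 < m) (hn : 0 < n) (q : Fin n) (D : Fin n → ℤ) :
    ∃ D', (completeMultigraph m n).IsReduced q D' ∧ LinEquiv m n D D' := by
  have hm' : (0 : ℤ) < m := by exact_mod_cast hm
  have hn' : (0 : ℤ) < n := by exact_mod_cast hn
  obtain ⟨E, ⟨hE, hE0⟩, hmin⟩ := exists_forall_le_of_nonneg
    (p := fun E => LinEquiv m n D E ∧ ∀ v, v ≠ q → 0 ≤ E v)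
    (fun E => ∑ i ∈ Finset.univ.erase q, E i)
    (fun E hE => Finset.sum_nonneg fun i hi => hE.2 i (Finset.ne_of_mem_erase hi)) (by
      -- The competitors are not empty: give `mn|D i|` to each `i ≠ q` at the expense of `q`. The
      -- entry at `q` makes the total of `a` vanish, so no correction term remains.
      set a : Fin n → ℤ := fun i => if i = q then -∑ j ∈ Finset.univ.erase q, |D j| else |D i|
      have hsum : ∑ j, a j = 0 := by
        rw [← Finset.add_sum_erase _ _ (Finset.mem_univ q),
          Finset.sum_congr rfl (g := fun j => |D j|)]
        · simp [a]
        · intro j hj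
          simp [a, Finset.ne_of_mem_erase hj]
      refine ⟨fun i => D i + m * (n * a i - ∑ j, a j), ⟨a, fun i => rfl⟩, fun v hv => ?_⟩
      simp only [hsum, a, if_neg hv, sub_zero]
      have h1 := neg_abs_le (D v)
      have h2 : 1 * |D v| ≤ ((m : ℤ) * n) * |D v| := by
        gcongr
        have := mul_pos hm' hn'
        omega
      linarith)
  refine ⟨E, ⟨hE0, fun S hS hq => ?_⟩, hE⟩
  by_contra! hall
  have hc : ((Sᶜ.card : ℕ) : ℤ) = n - S.card := by
    have := Finset.card_add_card_compl S
    rw [Fintype.card_fin] at this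
    omega
  have hs : (0 : ℤ) < S.card := by exact_mod_cast hS.card_pos
  have hms := mul_pos hm' hs
  -- If every vertex of `S` can afford its outgoing edges, sending chips along them keeps the
  -- divisor nonnegative off `q` while `q` gains `m|S| > 0`; the total off `q` drops, contradicting
  -- minimality.
  have hfire := LinEquiv.fire (m := m) E Sᶜ
  have h := hmin _ ⟨hE.trans hfire, fun v hv => ?_⟩
  · have h1 := hfire.sum_eq
    rw [← Finset.add_sum_erase _ _ (Finset.mem_univ q),
      ← Finset.add_sum_erase Finset.univ E (Finset.mem_univ q)] at h1
    simp only [hc, Finset.mem_compl, hq, not_false_eq_true, if_true] at h1 h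
    linarith
  · simp only [hc, Finset.mem_compl]
    by_cases hv' : v ∈ S
    · have := hall v hv'
      rw [completeMultigraph_outdeg hv'] at this
      simp only [hv', not_true_eq_false, if_false]
      linarith
    · have := hE0 v hv
      simp only [hv', not_false_eq_true, if_true]
      linarith

/-! ### Divisor classes of degree `g` and shift classes -/

theorem BreakDiv.smul_val (σ : Equiv.Perm (Fin n)) (D : BreakDiv m n) (i : Fin n) :
    (σ • D).1 i = D.1 (σ⁻¹ i) := rfl

theorem Park.smul_val {q : Fin n} (τ : Equiv.Perm {v : Fin n // v ≠ q}) (f : Park m n q)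
    (i : {v : Fin n // v ≠ q}) : (τ • f).1 i = f.1 (τ⁻¹ i) := rfl

theorem DSeq.smul_val (σ : Equiv.Perm (Fin n)) (x : DSeq m n) (i : Fin n) :
    (σ • x).1 i = x.1 (σ⁻¹ i) := rfl

/-- The reduction modulo `mn` of a divisor of degree `g`. -/
def DSeq.ofDivisor (D : Fin n → ℤ) (hD : ∑ i, D i = (completeMultigraph m n).genus) :
    DSeq m n :=
  ⟨fun i => (D i : ZMod (m * n)), by rw [← hD]; push_cast; rfl⟩

theorem DSeq.ofDivisor_surjective (hn : 0 < n) (x : DSeq m n) :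
    ∃ D hD, DSeq.ofDivisor D hD = x := by
  choose X hX using fun i => ZMod.intCast_surjective (x.1 i)
  have h : ((∑ i, X i - (completeMultigraph m n).genus : ℤ) : ZMod (m * n)) = 0 := by
    push_cast
    simp [hX, x.2]
  obtain ⟨t, ht⟩ := (ZMod.intCast_zmod_eq_zero_iff_dvd _ _).1 h
  -- An arbitrary lift has degree `g + mnt`; the excess is removed at one vertex without changing
  -- residues.
  refine ⟨X - Pi.single ⟨0, hn⟩ ((m * n : ℕ) * t), ?_, Subtype.ext (funext fun i => ?_)⟩
  · simp only [Pi.sub_apply, Finset.sum_sub_distrib, Finset.sum_pi_single', Finset.mem_univ,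
      if_true]
    linarith
  · have : ((((m * n : ℕ) : ℤ) * t : ℤ) : ZMod (m * n)) = 0 :=
      (ZMod.intCast_zmod_eq_zero_iff_dvd _ _).2 (dvd_mul_right _ _)
    by_cases hi : i = ⟨0, hn⟩
    · subst hi
      change (((X - Pi.single ⟨0, hn⟩ ((m * n : ℕ) * t) : Fin n → ℤ) _ : ℤ) : ZMod (m * n)) = _
      rw [Pi.sub_apply, Pi.single_eq_same, Int.cast_sub, this, hX, sub_zero]
    · change (((X - Pi.single ⟨0, hn⟩ ((m * n : ℕ) * t) : Fin n → ℤ) _ : ℤ) : ZMod (m * n)) = _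
      rw [Pi.sub_apply, Pi.single_eq_of_ne hi, sub_zero, hX]

/-- Shift-equivalence means `D' = D + mj + mn b` for an integer vector `b`, and equality of degrees
forces `j = -∑ b`, which is the Laplacian formula for `b`. Conversely, a Laplacian vector `a` acts
as `-∑ a` shifts. -/
theorem DSeq.ofDivisor_equiv_iff (hm : 0 < m) (hn : 0 < n) {D D' : Fin n → ℤ}
    (hD : ∑ i, D i = (completeMultigraph m n).genus)
    (hD' : ∑ i, D' i = (completeMultigraph m n).genus) :
    (shiftSetoid m n).r (DSeq.ofDivisor D hD) (DSeq.ofDivisor D' hD') ↔ LinEquiv m n D D' := by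
  have hm' : (m : ℤ) ≠ 0 := by exact_mod_cast hm.ne'
  have hn' : (n : ℤ) ≠ 0 := by exact_mod_cast hn.ne'
  constructor
  · rintro ⟨j, hj⟩
    have h : ∀ i, ∃ b : ℤ, D' i - (D i + m * j) = (m * n : ℕ) * b := by
      intro i
      have := congrFun (congrArg Subtype.val hj) i
      rw [shift_iterate_val] at this
      refine (ZMod.intCast_zmod_eq_zero_iff_dvd _ _).1 ?_
      change ((D i : ℤ) : ZMod (m * n)) + _ = ((D' i : ℤ) : ZMod (m * n)) at this
      push_cast at this ⊢
      rw [← this, sub_self]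
    choose b hb using h
    have hs : (m * n : ℤ) * (j + ∑ i, b i) = 0 := by
      have := Finset.sum_congr rfl fun i (_ : i ∈ Finset.univ) => hb i
      rw [← Finset.mul_sum, Finset.sum_sub_distrib, Finset.sum_add_distrib, hD, hD'] at this
      simp at this
      linarith
    have hs' := (mul_eq_zero.1 hs).resolve_left (mul_ne_zero hm' hn')
    refine ⟨b, fun i => ?_⟩
    have := hb i
    push_cast at this
    linear_combination this + m * hs'
  · rintro ⟨a, ha⟩
    -- The number of shifts has to be a natural number, so `-∑ a` is replaced by its residue modulo
    -- `n`.
    have hmod := Int.emod_nonneg (-∑ j, a j) hn'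
    refine ⟨((-∑ j, a j) % n).toNat, Subtype.ext (funext fun i => ?_)⟩
    rw [shift_iterate_val]
    change ((D i : ℤ) : ZMod (m * n)) + _ = ((D' i : ℤ) : ZMod (m * n))
    rw [← Int.cast_natCast, ← Int.cast_add, ZMod.intCast_eq_intCast_iff_dvd_sub, ha,
      Nat.cast_mul m (Int.toNat _), Int.toNat_of_nonneg hmod]
    have := Int.emod_add_mul_ediv (-∑ j, a j) n
    refine ⟨a i + (-∑ j, a j) / n, ?_⟩
    push_cast
    linear_combination -(m : ℤ) * this

/-- The shift class of a divisor of degree `g`. -/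
def DHat.ofDivisor (D : Fin n → ℤ) (hD : ∑ i, D i = (completeMultigraph m n).genus) :
    DHat m n :=
  Quotient.mk (shiftSetoid m n) (DSeq.ofDivisor D hD)

theorem DHat.ofDivisor_surjective (hn : 0 < n) (c : DHat m n) :
    ∃ D hD, DHat.ofDivisor D hD = c := by
  induction c using Quotient.inductionOn with
  | h x =>
    obtain ⟨D, hD, rfl⟩ := DSeq.ofDivisor_surjective hn x
    exact ⟨D, hD, rfl⟩

theorem DHat.ofDivisor_eq_iff (hm : 0 < m) (hn : 0 < n) {D D' : Fin n → ℤ}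
    (hD : ∑ i, D i = (completeMultigraph m n).genus)
    (hD' : ∑ i, D' i = (completeMultigraph m n).genus) :
    DHat.ofDivisor D hD = DHat.ofDivisor D' hD' ↔ LinEquiv m n D D' :=
  Quotient.eq.trans (DSeq.ofDivisor_equiv_iff hm hn hD hD')

/-- The class of a break divisor. -/
def BreakDiv.toDHat (D : BreakDiv m n) : DHat m n := DHat.ofDivisor D.1 D.2.degree

theorem BreakDiv.toDHat_smul (σ : Equiv.Perm (Fin n)) (D : BreakDiv m n) :
    (σ • D).toDHat = σ • D.toDHat := rfl

theorem BreakDiv.toDHat_bijective (hm : 0 < m) (hn : 0 < n) :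
    Function.Bijective (BreakDiv.toDHat (m := m) (n := n)) := by
  constructor
  · intro D D' h
    exact Subtype.ext
      (isBreakDivisor_unique D.2 D'.2 ((DHat.ofDivisor_eq_iff hm hn _ _).1 h)).symm
  · intro c
    obtain ⟨D, hD, rfl⟩ := DHat.ofDivisor_surjective hn c
    obtain ⟨E, hE, hDE⟩ := exists_isBreakDivisor hm hn hD
    exact ⟨⟨E, hE⟩, (DHat.ofDivisor_eq_iff hm hn _ _).2 hDE.symm⟩

/-- The divisor of degree `g` with prescribed values outside of `q`. -/
def degreeExtend (m : ℕ) (q : Fin n) (f : {v : Fin n // v ≠ q} → ℤ) (v : Fin n) : ℤ :=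
  if h : v = q then (completeMultigraph m n).genus - ∑ w, f w else f ⟨v, h⟩

theorem sum_eq_add_sum_ne (q : Fin n) (D : Fin n → ℤ) :
    ∑ v, D v = D q + ∑ w : {v : Fin n // v ≠ q}, D w := by
  rw [← Finset.add_sum_erase _ _ (Finset.mem_univ q)]
  congr 1
  exact Finset.sum_subtype _ (fun x => by simp) _

theorem degreeExtend_sum (q : Fin n) (f : {v : Fin n // v ≠ q} → ℤ) :
    ∑ v, degreeExtend m q f v = (completeMultigraph m n).genus := by
  rw [sum_eq_add_sum_ne q, Finset.sum_congr rfl (g := f)]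
  · simp [degreeExtend]
  · intro w _
    simp [degreeExtend, w.2]

theorem degreeExtend_restrict (q : Fin n) {D : Fin n → ℤ}
    (hD : ∑ v, D v = (completeMultigraph m n).genus) :
    degreeExtend m q (fun v => D v) = D := by
  funext v
  by_cases h : v = q
  · subst h
    rw [sum_eq_add_sum_ne v] at hD
    simp only [degreeExtend, dif_pos]
    linarith
  · simp [degreeExtend, h]

theorem Multigraph.IsReduced.congr {V : Type*} [Fintype V] [DecidableEq V] {G : Multigraph V}
    {q : V} {D D' : V → ℤ} (hD : G.IsReduced q D) (h : ∀ v, v ≠ q → D' v = D v) :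
    G.IsReduced q D' where
  nonneg v hv := (h v hv).symm ▸ hD.nonneg v hv
  debt S hS hq := by
    obtain ⟨v, hv, hlt⟩ := hD.debt S hS hq
    exact ⟨v, hv, (h v fun e => hq (e ▸ hv)).symm ▸ hlt⟩

theorem isReduced_degreeExtend {q : Fin n} {f : {v : Fin n // v ≠ q} → ℤ}
    (hf : (completeMultigraph m n).IsParkingFunction q f) :
    (completeMultigraph m n).IsReduced q (degreeExtend m q f) := by
  obtain ⟨D, hD, hfD⟩ := hf
  exact hD.congr fun v hv => by simp [degreeExtend, hv, hfD]

/-- The class of degree `g` of the reduced divisor extending a parking function. -/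
def Park.toDHat {q : Fin n} (f : Park m n q) : DHat m n :=
  DHat.ofDivisor (degreeExtend m q f.1) (degreeExtend_sum q f.1)

theorem degreeExtend_comp (q : Fin n) (τ : Equiv.Perm {v : Fin n // v ≠ q})
    (f : {v : Fin n // v ≠ q} → ℤ) (v : Fin n) :
    degreeExtend m q (fun w => f (τ w)) v = degreeExtend m q f (Equiv.Perm.ofSubtype τ v) := by
  by_cases h : v = q
  · subst h
    rw [Equiv.Perm.ofSubtype_apply_of_not_mem τ (by simp)]
    simp [degreeExtend, Equiv.sum_comp τ f]
  · rw [Equiv.Perm.ofSubtype_apply_of_mem τ h]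
    simp [degreeExtend, h, (τ ⟨v, h⟩).2]

theorem Park.toDHat_smul {q : Fin n} (τ : Equiv.Perm {v : Fin n // v ≠ q}) (f : Park m n q) :
    (τ • f).toDHat = Equiv.Perm.ofSubtype τ • f.toDHat := by
  refine congrArg (Quotient.mk (shiftSetoid m n)) (Subtype.ext (funext fun v => ?_))
  rw [DSeq.smul_val, ← map_inv]
  exact congrArg _ (degreeExtend_comp q τ⁻¹ f.1 v)

theorem Park.toDHat_bijective (hm : 0 < m) (hn : 0 < n) (q : Fin n) :
    Function.Bijective (Park.toDHat (m := m) (q := q)) := by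
  constructor
  · intro f f' h
    have := isReduced_unique (isReduced_degreeExtend f.2) (isReduced_degreeExtend f'.2)
      ((DHat.ofDivisor_eq_iff hm hn _ _).1 h)
    refine Subtype.ext (funext fun v => ?_)
    have := congrFun this v.1
    simpa [degreeExtend, v.2] using this.symm
  · intro c
    obtain ⟨D, hD, rfl⟩ := DHat.ofDivisor_surjective hn c
    obtain ⟨E, hE, hDE⟩ := exists_isReduced hm hn q D
    refine ⟨⟨fun v => E v, E, hE, fun v => rfl⟩, (DHat.ofDivisor_eq_iff hm hn _ _).2 ?_⟩
    rw [degreeExtend_restrict q (hDE.sum_eq.trans hD)]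
    exact hDE.symm

/-- An equivariant bijection induces an isomorphism of permutation representations. -/
theorem nonempty_ofMulAction_equiv {k G H X Y : Type*} [CommSemiring k] [Group G] [Group H]
    [MulAction G X] [MulAction H Y] (φ : H →* G) (e : X ≃ Y)
    (he : ∀ (h : H) x, e (φ h • x) = h • e x) :
    Nonempty (Representation.Equiv ((Representation.ofMulAction k G X).comp φ)
      (Representation.ofMulAction k H Y)) := by
  refine ⟨.mk (((MonoidAlgebra.coeffLinearEquiv k).trans (Finsupp.domLCongr e)).trans
    (MonoidAlgebra.coeffLinearEquiv k).symm) fun h => ?_⟩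
  apply MonoidAlgebra.lhom_ext'
  intro x
  ext
  simp [Representation.ofMulAction_def, he]

/-! ### Orbits -/

theorem DSeq.shift_injective : Function.Injective (DSeq.shift (m := m) (n := n)) := by
  intro x y h
  refine Subtype.ext (funext fun i => ?_)
  exact add_right_cancel (congrFun (congrArg Subtype.val h) i)

theorem DSeq.shift_iterate_mod (j : ℕ) (x : DSeq m n) :
    DSeq.shift^[j % n] x = DSeq.shift^[j] x := by
  refine Subtype.ext (funext fun i => ?_)
  rw [shift_iterate_val, shift_iterate_val]
  congr 1
  rw [ZMod.natCast_eq_natCast_iff]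
  exact Nat.ModEq.mul_left' m (Nat.mod_modEq j n)

theorem two_dvd_mul_succ (j : ℤ) : 2 ∣ j * (j + 1) :=
  (Int.even_mul_succ_self j).two_dvd

/-- The cyclic group of shifts acts freely on the `S_n`-orbits of sequences. -/
theorem DSeq.dvd_of_shift_eq_smul (hm : 0 < m) (hn : 0 < n) {x : DSeq m n} {j : ℕ}
    {σ : Equiv.Perm (Fin n)} (h : DSeq.shift^[j] x = σ • x) : n ∣ j := by
  have hm' : (m : ℤ) ≠ 0 := by exact_mod_cast hm.ne'
  have hn' : (n : ℤ) ≠ 0 := by exact_mod_cast hn.ne'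
  obtain ⟨X, hX, rfl⟩ := DSeq.ofDivisor_surjective hn x
  have hb : ∀ i, ∃ b : ℤ, X (σ⁻¹ i) - (X i + m * j) = (m * n : ℕ) * b := by
    intro i
    have := congrFun (congrArg Subtype.val h) i
    rw [shift_iterate_val] at this
    refine (ZMod.intCast_zmod_eq_zero_iff_dvd _ _).1 ?_
    change ((X i : ℤ) : ZMod (m * n)) + _ = ((X (σ⁻¹ i) : ℤ) : ZMod (m * n)) at this
    push_cast at this ⊢
    rw [← this, sub_self]
  choose b hb using hb
  have hb' : ∀ i, X (σ⁻¹ i) = X i + m * j + m * n * b i := fun i => by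
    have := hb i
    push_cast at this
    linarith
  -- Permuting coordinates preserves both the sum and the sum of squares. The sum gives this; the
  -- sum of squares, divided by `m`, gives `hsq`.
  have hs : ∑ i, b i = -j := by
    have h1 := Equiv.sum_comp σ⁻¹ X
    simp only [hb', Finset.sum_add_distrib, Finset.sum_const, Finset.card_univ, Fintype.card_fin,
      nsmul_eq_mul, ← Finset.mul_sum] at h1
    have h2 : (m * n : ℤ) * (∑ i, b i + j) = 0 := by linarith
    have := (mul_eq_zero.1 h2).resolve_left (mul_ne_zero hm' hn')
    linarith
  obtain ⟨t, ht⟩ : (2 : ℤ) ∣ ∑ i, b i ^ 2 - ∑ i, b i := by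
    rw [← Finset.sum_sub_distrib]
    refine Finset.dvd_sum fun i _ => ?_
    have := two_dvd_mul_succ (b i - 1)
    rwa [sub_add_cancel, sub_mul, one_mul, ← sq] at this
  obtain ⟨u, hu⟩ := two_dvd_mul_succ (j : ℤ)
  have hsq : 2 * ((j : ℤ) * (completeMultigraph m n).genus) + 2 * n * ∑ i, b i * X i
      - n * m * (j : ℤ) ^ 2 + m * n ^ 2 * ∑ i, b i ^ 2 = 0 := by
    have h1 := Equiv.sum_comp σ⁻¹ fun i => X i ^ 2
    have e1 : ∀ i, (X i + m * j + m * n * b i) ^ 2 = X i ^ 2 + 2 * m * j * X i +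
        2 * m * n * (b i * X i) + (m * j : ℤ) ^ 2 + 2 * m ^ 2 * n * j * b i +
          (m * n) ^ 2 * b i ^ 2 := fun i => by ring
    simp only [hb', e1, Finset.sum_add_distrib, Finset.sum_const, Finset.card_univ,
      Fintype.card_fin, nsmul_eq_mul, ← Finset.mul_sum, hX, hs] at h1
    refine (mul_eq_zero.1 (?_ : (m : ℤ) * _ = 0)).resolve_left hm'
    linear_combination h1
  have hg := two_mul_genus m n
  -- The summand `+2` of `2g` leaves `2j` on its own, all other terms being divisible by `n`. The
  -- evenness of `∑ b² - ∑ b` and of `j(j+1)` provides the factor `2`, so that `n ∣ j` also for even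
  -- `n`.
  have hfin : (2 : ℤ) * j = 2 * (n * (j - ∑ i, b i * X i + m * (u - n * t))) := by
    rw [hs] at ht
    linear_combination hsq - (j : ℤ) * hg - (m : ℤ) * n ^ 2 * ht + (m : ℤ) * n * hu
  have : (j : ℤ) = n * (j - ∑ i, b i * X i + m * (u - n * t)) := by linarith
  exact_mod_cast Dvd.intro _ this.symm

abbrev PermOrbits (n : ℕ) (X : Type*) [MulAction (Equiv.Perm (Fin n)) X] : Type _ :=
  MulAction.orbitRel.Quotient (Equiv.Perm (Fin n)) X

theorem permOrbits_mk_eq_iff {X : Type*} [MulAction (Equiv.Perm (Fin n)) X] {x y : X} :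
    (Quotient.mk _ x : PermOrbits n X) = Quotient.mk _ y ↔
      ∃ σ : Equiv.Perm (Fin n), σ • y = x :=
  Quotient.eq.trans Iff.rfl

theorem card_permOrbits_congr {X Y : Type*} [MulAction (Equiv.Perm (Fin n)) X]
    [MulAction (Equiv.Perm (Fin n)) Y] (e : X ≃ Y)
    (he : ∀ (σ : Equiv.Perm (Fin n)) x, e (σ • x) = σ • e x) :
    Nat.card (PermOrbits n X) = Nat.card (PermOrbits n Y) := by
  refine Nat.card_congr (Quotient.congr e fun x y => ?_)
  change (∃ σ : Equiv.Perm (Fin n), σ • y = x) ↔ ∃ σ : Equiv.Perm (Fin n), σ • e y = e x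
  simp [← he]

theorem DHat.mk_eq_iff {x y : DSeq m n} :
    (Quotient.mk (shiftSetoid m n) x : DHat m n) = Quotient.mk (shiftSetoid m n) y ↔
      ∃ j : ℕ, DSeq.shift^[j] x = y :=
  Quotient.eq.trans Iff.rfl

/-- The shift commutes with `S_n` and its `n`-th power is the identity, so a representative of each
orbit of classes, shifted `0, …, n-1` times, meets every orbit of sequences above it; freeness makes
these orbits distinct. -/
theorem card_permOrbits_dSeq (hm : 0 < m) (hn : 0 < n) :
    Nat.card (PermOrbits n (DSeq m n)) = n * Nat.card (PermOrbits n (DHat m n)) := by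
  have hrep : ∀ p : PermOrbits n (DHat m n), ∃ x : DSeq m n,
      (Quotient.mk _ (Quotient.mk (shiftSetoid m n) x : DHat m n) : PermOrbits n (DHat m n)) = p := by
    intro p
    induction p using Quotient.inductionOn with
    | h c =>
      induction c using Quotient.inductionOn with
      | h x => exact ⟨x, rfl⟩
  choose rep hrep using hrep
  let f : Fin n × PermOrbits n (DHat m n) → PermOrbits n (DSeq m n) :=
    fun jp => Quotient.mk _ (DSeq.shift^[jp.1] (rep jp.2))
  have hf : Function.Bijective f := by
    constructor
    · have key : ∀ {i j : Fin n} {p r : PermOrbits n (DHat m n)}, j ≤ i →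
          f (i, p) = f (j, r) → (i, p) = (j, r) := by
        intro i j p r hij h
        obtain ⟨σ, hσ⟩ := permOrbits_mk_eq_iff.1 h
        change σ • DSeq.shift^[j] (rep r) = DSeq.shift^[i] (rep p) at hσ
        have hpr : p = r := by
          rw [← hrep p, ← hrep r]
          refine permOrbits_mk_eq_iff.2 ⟨σ, ?_⟩
          have h1 : (Quotient.mk (shiftSetoid m n) (rep p) : DHat m n) =
              Quotient.mk (shiftSetoid m n) (DSeq.shift^[i] (rep p)) :=
            DHat.mk_eq_iff.2 ⟨i, rfl⟩
          have h2 : (Quotient.mk (shiftSetoid m n) (rep r) : DHat m n) =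
              Quotient.mk (shiftSetoid m n) (DSeq.shift^[j] (rep r)) :=
            DHat.mk_eq_iff.2 ⟨j, rfl⟩
          rw [h1, h2, ← hσ]
          rfl
        subst hpr
        have hij' : (i : ℕ) = j + (i - j) := by omega
        rw [← DSeq.shift_iterate_smul, hij', Function.iterate_add_apply] at hσ
        have hd := DSeq.dvd_of_shift_eq_smul hm hn (DSeq.shift_injective.iterate _ hσ).symm
        have : (i : ℕ) - j = 0 := Nat.eq_zero_of_dvd_of_lt hd (by omega)
        have : i = j := by omega
        rw [this]
      rintro ⟨i, p⟩ ⟨j, r⟩ h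
      rcases le_total j i with hij | hij
      · exact key hij h
      · exact (key hij h.symm).symm
    · intro o
      induction o using Quotient.inductionOn with
      | h y =>
        obtain ⟨σ, hσ⟩ := permOrbits_mk_eq_iff.1 (hrep (Quotient.mk _ (Quotient.mk _ y)))
        obtain ⟨j, hj⟩ := DHat.mk_eq_iff.1 hσ.symm
        refine ⟨(⟨j % n, Nat.mod_lt _ hn⟩, Quotient.mk _ (Quotient.mk _ y)), ?_⟩
        refine permOrbits_mk_eq_iff.2 ⟨σ, ?_⟩
        change σ • y = DSeq.shift^[j % n] _
        rw [DSeq.shift_iterate_mod, hj]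
  rw [← Nat.card_congr (Equiv.ofBijective f hf), Nat.card_prod, Nat.card_fin]

theorem exists_perm_of_map_univ_eq {ι α : Type*} [Fintype ι] [DecidableEq α] {f g : ι → α}
    (h : Finset.univ.val.map f = Finset.univ.val.map g) : ∃ σ : Equiv.Perm ι, g ∘ σ = f := by
  have hc : ∀ a, Nonempty ({i // f i = a} ≃ {i // g i = a}) := by
    intro a
    rw [← Fintype.card_eq]
    have := congrArg (Multiset.count a) h
    rw [Multiset.count_map, Multiset.count_map] at this
    rw [Fintype.card_subtype, Fintype.card_subtype]
    simpa [eq_comm, Finset.card_def] using this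
  let e := fun a => (hc a).some
  refine ⟨(Equiv.sigmaFiberEquiv f).symm.trans ((Equiv.sigmaCongrRight e).trans
    (Equiv.sigmaFiberEquiv g)), funext fun i => ?_⟩
  exact (e (f i) ⟨i, rfl⟩).2

theorem exists_map_univ_eq {α : Type*} {n : ℕ} {s : Multiset α} (hs : s.card = n) :
    ∃ f : Fin n → α, Finset.univ.val.map f = s := by
  subst hs
  induction s using Quotient.inductionOn with
  | h l => exact ⟨l.get, (Fin.univ_val_map l.get).trans (congrArg Multiset.ofList (List.ofFn_get l))⟩

/-- Orbits of sequences are multisets of `n` residues. -/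
theorem card_permOrbits_dSeq_eq (m n : ℕ) :
    Nat.card (PermOrbits n (DSeq m n)) =
      Nat.card {s : Multiset (ZMod (m * n)) //
        s.card = n ∧ s.sum = ((completeMultigraph m n).genus : ZMod (m * n))} := by
  let F : PermOrbits n (DSeq m n) → {s : Multiset (ZMod (m * n)) //
      s.card = n ∧ s.sum = ((completeMultigraph m n).genus : ZMod (m * n))} :=
    Quotient.lift (fun x => ⟨Finset.univ.val.map x.1, by simp, x.2⟩) (by
      rintro _ y ⟨σ, rfl⟩
      refine Subtype.ext ?_
      change Finset.univ.val.map (y.1 ∘ ⇑σ⁻¹) = Finset.univ.val.map y.1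
      rw [← Multiset.map_map, Multiset.map_univ_val_equiv])
  refine Nat.card_congr (Equiv.ofBijective F ⟨?_, ?_⟩)
  · intro o o' h
    induction o using Quotient.inductionOn with
    | h x =>
      induction o' using Quotient.inductionOn with
      | h y =>
        obtain ⟨σ, hσ⟩ := exists_perm_of_map_univ_eq (f := x.1) (g := y.1)
          (congrArg Subtype.val h)
        refine permOrbits_mk_eq_iff.2 ⟨σ⁻¹, Subtype.ext (funext fun i => ?_)⟩
        rw [DSeq.smul_val, inv_inv]
        exact congrFun hσ i
  · rintro ⟨s, hs, hsum⟩
    obtain ⟨f, rfl⟩ := exists_map_univ_eq hs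
    exact ⟨Quotient.mk _ ⟨f, hsum⟩, rfl⟩

end

/-! ### Counting multisets of residues with prescribed sum -/

-- Multiplication by a primitive root `ζ` permutes the roots of unity and scales the sum by `ζ ^ t`,
-- so the sum vanishes unless `ζ ^ t = 1`.
open Polynomial in
theorem sum_nthRootsFinset_zpow {N : ℕ} (hN : 0 < N) (t : ℤ) :
    ∑ ω ∈ nthRootsFinset N (1 : ℂ), ω ^ t = if (N : ℤ) ∣ t then (N : ℂ) else 0 := by
  obtain ⟨ζ, hζ⟩ : ∃ ζ : ℂ, IsPrimitiveRoot ζ N := ⟨_, Complex.isPrimitiveRoot_exp N hN.ne'⟩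
  have hζ0 : ζ ≠ 0 := hζ.ne_zero hN.ne'
  split_ifs with h
  · rw [Finset.sum_congr rfl (g := fun _ => 1)]
    · simp [hζ.card_nthRootsFinset]
    · intro ω hω
      obtain ⟨s, rfl⟩ := h
      rw [zpow_mul, zpow_natCast, (mem_nthRootsFinset hN _).1 hω, one_zpow]
  · have h1 : ∑ ω ∈ nthRootsFinset N (1 : ℂ), ω ^ t =
        ζ ^ t * ∑ ω ∈ nthRootsFinset N (1 : ℂ), ω ^ t := by
      rw [Finset.mul_sum]
      refine Finset.sum_nbij' (fun ω => ω * ζ⁻¹) (fun ω => ω * ζ) ?_ ?_ ?_ ?_ ?_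
      · intro ω hω
        rw [mem_nthRootsFinset hN] at hω ⊢
        rw [mul_pow, hω, inv_pow, hζ.pow_eq_one, inv_one, mul_one]
      · intro ω hω
        rw [mem_nthRootsFinset hN] at hω ⊢
        rw [mul_pow, hω, hζ.pow_eq_one, mul_one]
      · intro ω _
        field_simp
      · intro ω _
        field_simp
      · intro ω _
        rw [← mul_zpow]
        congr 1
        field_simp
    have h2 : ζ ^ t ≠ 1 := fun h' => h ((hζ.zpow_eq_one_iff_dvd t).1 h')
    have h3 : (1 - ζ ^ t) * ∑ ω ∈ nthRootsFinset N (1 : ℂ), ω ^ t = 0 := by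
      linear_combination h1
    exact (mul_eq_zero.1 h3).resolve_left (sub_ne_zero.2 h2.symm)

open Polynomial in
theorem sum_nthRootsFinset_eq_sum_divisors {N : ℕ} (f : ℂ → ℂ) :
    ∑ ω ∈ nthRootsFinset N (1 : ℂ), f ω =
      ∑ k ∈ N.divisors, ∑ ω ∈ primitiveRoots k ℂ, f ω := by
  rw [IsPrimitiveRoot.nthRoots_one_eq_biUnion_primitiveRoots, Finset.sum_biUnion]
  exact fun i _ j _ hij => IsPrimitiveRoot.disjoint hij

/-- Summed over the divisors of `N`, these sums give the sum of `ω⁻¹` over all `N`-th roots of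
unity, which is `1` for `N = 1` and `0` otherwise; Möbius inversion then yields `μ`. -/
theorem sum_primitiveRoots_inv {k : ℕ} (hk : 0 < k) :
    ∑ ω ∈ primitiveRoots k ℂ, ω⁻¹ = (ArithmeticFunction.moebius k : ℂ) := by
  have h := (ArithmeticFunction.sum_eq_iff_sum_mul_moebius_eq (R := ℂ)
    (f := fun k => ∑ ω ∈ primitiveRoots k ℂ, ω⁻¹) (g := fun k => if k = 1 then 1 else 0)).1 (by
      intro N hN
      rw [← sum_nthRootsFinset_eq_sum_divisors]
      have := sum_nthRootsFinset_zpow hN (-1)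
      simp only [zpow_neg_one] at this
      rw [this]
      have : (N : ℤ) ∣ -1 ↔ N = 1 := by
        rw [dvd_neg, Int.natCast_dvd]
        simp
      simp only [this]
      split_ifs with h
      · simp [h]
      · rfl) k hk
  rw [← h, Finset.sum_eq_single (k, 1)]
  · simp
  · rintro ⟨a, b⟩ hab hne
    have := (Nat.mem_divisorsAntidiagonal.1 hab).1
    simp only [mul_ite, mul_one, mul_zero, ite_eq_right_iff]
    rintro rfl
    simp at this
    simp [this] at hne
  · intro h
    simp [hk.ne'] at h

/-! ### The generating function of multisets at a root of unity -/

open PowerSeries in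
theorem mk_pow_mul_one_sub {R : Type*} [CommRing R] (a : R) :
    (PowerSeries.mk fun j => a ^ j) * (1 - C a * X) = 1 := by
  have h := congrArg (rescale a) (mk_one_mul_one_sub_eq_one R)
  rw [map_mul, map_sub, map_one, rescale_X] at h
  refine Eq.trans ?_ h
  congr 1
  ext j
  simp

open PowerSeries in
theorem prod_range_one_sub_primitiveRoot {k : ℕ} (hk : 0 < k) {ω : ℂ} (hω : IsPrimitiveRoot ω k) :
    ∏ i ∈ Finset.range k, (1 - C (ω ^ i) * X) = (1 - X ^ k : PowerSeries ℂ) := by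
  have hω' : IsPrimitiveRoot (C ω : PowerSeries ℂ) k := hω.map_of_injective C_injective
  have h := hω'.pow_sub_pow_eq_prod_sub_mul (x := 1) (y := (X : PowerSeries ℂ)) hk
  rw [one_pow] at h
  rw [h]
  refine Finset.prod_nbij (fun i => (C ω : PowerSeries ℂ) ^ i) ?_ ?_ ?_ ?_
  · intro i _
    rw [Polynomial.mem_nthRootsFinset hk, ← pow_mul, mul_comm, pow_mul, hω'.pow_eq_one, one_pow]
  · intro i hi j hj hij
    exact hω'.pow_inj (Finset.mem_range.1 hi) (Finset.mem_range.1 hj) hij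
  · intro ζ hζ
    have : NeZero k := ⟨hk.ne'⟩
    obtain ⟨i, hi, rfl⟩ := hω'.eq_pow_of_pow_eq_one ((Polynomial.mem_nthRootsFinset hk _).1 hζ)
    exact ⟨i, by simpa using hi, rfl⟩
  · intro i _
    rw [map_pow]

open PowerSeries in
theorem prod_range_mul_one_sub_primitiveRoot {k : ℕ} (hk : 0 < k) {ω : ℂ}
    (hω : IsPrimitiveRoot ω k) (l : ℕ) :
    ∏ i ∈ Finset.range (k * l), (1 - C (ω ^ i) * X) = (1 - X ^ k : PowerSeries ℂ) ^ l := by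
  induction l with
  | zero => simp
  | succ l ih =>
    rw [mul_add, mul_one, Finset.prod_range_add, ih, pow_succ,
      ← prod_range_one_sub_primitiveRoot hk hω]
    simp [pow_add, pow_mul, hω.pow_eq_one]

theorem ZMod.prod_val_eq_prod_range {M : Type*} [CommMonoid M] {N : ℕ} [NeZero N] (f : ℕ → M) :
    ∏ a : ZMod N, f a.val = ∏ i ∈ Finset.range N, f i := by
  refine Finset.prod_nbij ZMod.val (fun a _ => Finset.mem_range.2 a.val_lt)
    (fun a _ b _ h => ZMod.val_injective N h) (fun i hi => ?_) fun _ _ => rfl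
  exact ⟨i, Finset.mem_coe.2 (Finset.mem_univ _), ZMod.val_cast_of_lt (by simpa using hi)⟩

-- As `a` runs over `ZMod (k * l)`, `ω ^ a.val` takes each `k`-th root of unity `l` times, so the
-- product is `(1 - X ^ k) ^ (-l)`.
open PowerSeries in
theorem prod_mk_primitiveRoot {k l : ℕ} (hk : 0 < k) {ω : ℂ} (hω : IsPrimitiveRoot ω k)
    [NeZero (k * l)] :
    ∏ a : ZMod (k * l), (PowerSeries.mk fun j => (ω ^ a.val) ^ j) =
      expand k hk.ne' (invOneSubPow ℂ l).val := by
  have h1 : (∏ a : ZMod (k * l), (PowerSeries.mk fun j => (ω ^ a.val) ^ j)) *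
      (1 - X ^ k) ^ l = 1 := by
    rw [← prod_range_mul_one_sub_primitiveRoot hk hω, ← ZMod.prod_val_eq_prod_range
      (fun i => (1 - C (ω ^ i) * X : PowerSeries ℂ)), ← Finset.prod_mul_distrib]
    exact Finset.prod_eq_one fun a _ => mk_pow_mul_one_sub _
  have h2 : (1 - X ^ k : PowerSeries ℂ) ^ l * expand k hk.ne' (invOneSubPow ℂ l).val = 1 := by
    have := congrArg (expand k hk.ne') (invOneSubPow ℂ l).inv_val
    rw [invOneSubPow_inv_eq_one_sub_pow] at this
    simpa using this
  exact left_inv_eq_right_inv h1 h2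

/-- Multisets of size `n` with prescribed sum, counted by their generating functions twisted by
roots of unity. -/
theorem card_multiset_sum_eq {N : ℕ} [NeZero N] (n : ℕ) (r : ℤ) :
    (N : ℂ) * Nat.card {s : Multiset (ZMod N) // s.card = n ∧ s.sum = (r : ZMod N)} =
      ∑ ω ∈ Polynomial.nthRootsFinset N (1 : ℂ), ω ^ (-r) *
        PowerSeries.coeff n (∏ a : ZMod N, (PowerSeries.mk fun j => (ω ^ a.val) ^ j)) := by
  have hN : 0 < N := NeZero.pos N
  let T := (Finset.finsuppAntidiag (Finset.univ : Finset (ZMod N)) n).filter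
    fun c => ∑ a, c a • a = (r : ZMod N)
  have hcard : Nat.card {s : Multiset (ZMod N) // s.card = n ∧ s.sum = (r : ZMod N)} =
      T.card := by
    rw [← Nat.card_eq_finsetCard]
    refine Nat.card_congr (Multiset.toFinsupp.toEquiv.subtypeEquiv fun s => ?_)
    have h1 : s.card = ∑ a, s.count a :=
      (Multiset.sum_count_eq_card fun a _ => Finset.mem_univ a).symm
    have h2 : s.sum = ∑ a, s.count a • a :=
      Finset.sum_multiset_count_of_subset s Finset.univ (Finset.subset_univ _)
    rw [h1, h2, Finset.mem_filter, Finset.mem_finsuppAntidiag]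
    simp only [Finset.subset_univ, and_true]
    rfl
  rw [hcard]
  simp only [PowerSeries.coeff_prod, PowerSeries.coeff_mk, Finset.mul_sum]
  rw [Finset.sum_comm, Finset.card_filter]
  push_cast
  rw [Finset.mul_sum]
  refine Finset.sum_congr rfl fun c _ => ?_
  have h1 : ∀ ω ∈ Polynomial.nthRootsFinset N (1 : ℂ),
      ω ^ (-r) * ∏ a : ZMod N, (ω ^ a.val) ^ c a =
        ω ^ ((∑ a : ZMod N, (a.val * c a : ℕ) : ℤ) - r) := by
    intro ω hω
    have hω0 : ω ≠ 0 := by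
      rintro rfl
      simp [Polynomial.mem_nthRootsFinset hN, hN.ne'] at hω
    rw [sub_eq_neg_add, zpow_add₀ hω0, ← Nat.cast_sum, zpow_natCast, ← Finset.prod_pow_eq_pow_sum]
    simp only [pow_mul]
  -- A multiset is encoded by its multiplicities `c`; summing over `ω` tests whether its sum is `r`.
  rw [Finset.sum_congr rfl h1, sum_nthRootsFinset_zpow hN]
  have h2 : (N : ℤ) ∣ (∑ a : ZMod N, (a.val * c a : ℕ) : ℤ) - r ↔
      ∑ a, c a • a = (r : ZMod N) := by
    rw [← ZMod.intCast_zmod_eq_zero_iff_dvd, Int.cast_sub, sub_eq_zero]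
    simp only [Int.cast_sum, Int.cast_natCast, Int.cast_mul, Nat.cast_mul, ZMod.natCast_zmod_val, nsmul_eq_mul,
      mul_comm]
  simp only [h2]
  split_ifs <;> simp

/-- The exponent `kd(kd-1)/2` is a multiple of `k` unless `k` is even and `d` odd; then it is an odd
multiple of `k/2`, and `ω ^ (k/2) = -1`. -/
theorem IsPrimitiveRoot.pow_choose_two {R : Type*} [CommRing R] [IsDomain R] {k d : ℕ} {ω : R}
    (hω : IsPrimitiveRoot ω k) (hk : 0 < k) :
    ω ^ ((k * d).choose 2) = (-1) ^ (k * d + d) := by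
  have h2 : ((k * d).choose 2) * 2 = k * d * (k * d - 1) := by
    rw [Nat.choose_two_right]
    exact Nat.div_mul_cancel (Nat.even_mul_pred_self _).two_dvd
  rcases Nat.even_or_odd d with hd | hd
  · obtain ⟨e, rfl⟩ := hd.two_dvd
    have : (k * (2 * e)).choose 2 = k * (e * (k * (2 * e) - 1)) := by
      apply Nat.eq_of_mul_eq_mul_right two_pos
      rw [h2]
      ring
    rw [this, pow_mul, hω.pow_eq_one, one_pow, Even.neg_one_pow]
    exact ((even_two_mul e).mul_left k).add (even_two_mul e)
  · rcases Nat.even_or_odd k with hk' | hk'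
    · obtain ⟨h, rfl⟩ := hk'.two_dvd
      have : (2 * h * d).choose 2 = h * (d * (2 * h * d - 1)) := by
        apply Nat.eq_of_mul_eq_mul_right two_pos
        rw [h2]
        ring
      have hω' : ω ^ h = -1 := by
        have h3 : ω ^ h * ω ^ h = 1 := by rw [← pow_add, ← two_mul, hω.pow_eq_one]
        refine (mul_self_eq_one_iff.1 h3).resolve_left fun h4 => ?_
        have := Nat.le_of_dvd (by omega) (hω.dvd_of_pow_eq_one h h4)
        omega
      have hpos : 0 < 2 * h * d := Nat.mul_pos hk hd.pos
      have ho : Odd (2 * h * d - 1) := by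
        refine Nat.Even.sub_odd hpos ?_ odd_one
        rw [mul_assoc]
        exact even_two_mul _
      have he : Even (2 * h * d) := by
        rw [mul_assoc]
        exact even_two_mul _
      rw [this, pow_mul, hω', Odd.neg_one_pow (hd.mul ho), Odd.neg_one_pow (he.add_odd hd)]
    · obtain ⟨e, he⟩ := (hk'.mul hd)
      have : (k * d).choose 2 = k * (d * e) := by
        apply Nat.eq_of_mul_eq_mul_right two_pos
        rw [h2, he, ← mul_assoc, he]
        simp
        ring
      rw [this, pow_mul, hω.pow_eq_one, one_pow, Even.neg_one_pow ((hk'.mul hd).add_odd hd)]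

theorem primitiveRoot_zpow_neg_genus {m n k d : ℕ} (hn : n = k * d) (hk : 0 < k) {ω : ℂ}
    (hω : IsPrimitiveRoot ω k) :
    ω ^ (-(completeMultigraph m n).genus) = (-1) ^ (m * (n + d)) * ω⁻¹ := by
  have hω0 := hω.ne_zero hk.ne'
  have h1 : (completeMultigraph m n).genus = (((k * d).choose 2 * m : ℕ) : ℤ) - (k : ℤ) * d + 1 := by
    rw [Multigraph.genus, completeMultigraph_genusOn, Finset.card_univ, Fintype.card_fin, hn]
    push_cast
    ring
  have h2 : ω ^ ((k : ℤ) * d) = 1 := by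
    rw [← Nat.cast_mul, zpow_natCast, pow_mul, hω.pow_eq_one, one_pow]
  rw [h1, zpow_neg, zpow_add₀ hω0, zpow_sub₀ hω0, h2, zpow_natCast, pow_mul,
    hω.pow_choose_two hk, zpow_one, div_one, mul_inv, ← pow_mul, mul_comm _ m, hn]
  congr 1
  rw [← inv_pow]
  norm_num

/-- An absorption identity. It exposes the factor `m` that cancels against the modulus `mn` in the
count and against `mn + 1 - 1` in the convolution for the tree series. -/
theorem choose_mul_eq (m d : ℕ) (hm : 0 < m) (hd : 0 < d) :
    (m * d - 1 + d).choose (m * d - 1) = m * ((m + 1) * d - 1).choose (m * d) := by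
  have hmd : 0 < m * d := Nat.mul_pos hm hd
  have h1 : (m + 1) * d - 1 = m * d - 1 + d := by
    rw [add_mul, one_mul]
    omega
  have h2 := Nat.choose_succ_right_eq (m * d - 1 + d) (m * d - 1)
  rw [Nat.sub_add_cancel hmd, Nat.add_sub_cancel_left] at h2
  rw [h1]
  apply Nat.eq_of_mul_eq_mul_right hd
  rw [← h2]
  ring

theorem coeff_expand_invOneSubPow {m n k l : ℕ} (hm : 0 < m) (hn : 0 < n) (hk : 0 < k)
    (hkl : k * l = m * n) :
    PowerSeries.coeff n (PowerSeries.expand k hk.ne' (PowerSeries.invOneSubPow ℂ l).val) =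
      if k ∣ n then (m * (((m + 1) * (n / k) - 1).choose (m * (n / k)) : ℕ) : ℂ) else 0 := by
  split_ifs with h
  · obtain ⟨d, rfl⟩ := h
    have hd : 0 < d := Nat.pos_of_mul_pos_left hn
    have hl : l = m * d := by
      apply Nat.eq_of_mul_eq_mul_left hk
      rw [hkl]
      ring
    rw [PowerSeries.coeff_expand_mul, hl,
      PowerSeries.invOneSubPow_val_eq_mk_sub_one_add_choose_of_pos _ _ (Nat.mul_pos hm hd),
      PowerSeries.coeff_mk, choose_mul_eq m d hm hd, Nat.mul_div_cancel_left d hk]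
    push_cast
    rfl
  · exact PowerSeries.coeff_expand_of_not_dvd _ _ _ h

theorem card_permOrbits_dSeq_formula {m n : ℕ} (hm : 0 < m) (hn : 0 < n) :
    (n : ℂ) * Nat.card (PermOrbits n (DSeq m n)) =
      ∑ d ∈ n.divisors, (-1 : ℂ) ^ (m * (n + d)) *
        (ArithmeticFunction.moebius (n / d) : ℂ) * (((m + 1) * d - 1).choose (m * d) : ℂ) := by
  have hN : 0 < m * n := Nat.mul_pos hm hn
  have : NeZero (m * n) := ⟨hN.ne'⟩
  have hm0 : (m : ℂ) ≠ 0 := by exact_mod_cast hm.ne'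
  have h := card_multiset_sum_eq (N := m * n) n (completeMultigraph m n).genus
  rw [← card_permOrbits_dSeq_eq, sum_nthRootsFinset_eq_sum_divisors] at h
  have h1 : ∀ k ∈ (m * n).divisors, ∑ ω ∈ primitiveRoots k ℂ,
      ω ^ (-(completeMultigraph m n).genus) * PowerSeries.coeff n
        (∏ a : ZMod (m * n), (PowerSeries.mk fun j => (ω ^ a.val) ^ j)) =
      if k ∣ n then m * ((-1 : ℂ) ^ (m * (n + n / k)) * (ArithmeticFunction.moebius k : ℂ) *
        (((m + 1) * (n / k) - 1).choose (m * (n / k)) : ℂ)) else 0 := by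
    intro k hk
    have hk0 := Nat.pos_of_mem_divisors hk
    obtain ⟨l, hl⟩ := Nat.dvd_of_mem_divisors hk
    have hc : ∀ ω ∈ primitiveRoots k ℂ, PowerSeries.coeff n
        (∏ a : ZMod (m * n), (PowerSeries.mk fun j => (ω ^ a.val) ^ j)) =
        if k ∣ n then (m * (((m + 1) * (n / k) - 1).choose (m * (n / k)) : ℕ) : ℂ) else 0 := by
      intro ω hω
      rw [← coeff_expand_invOneSubPow hm hn hk0 hl.symm]
      have : NeZero (k * l) := ⟨hl ▸ hN.ne'⟩
      rw [← prod_mk_primitiveRoot hk0 ((mem_primitiveRoots hk0).1 hω)]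
      congr 1
      rw [ZMod.prod_val_eq_prod_range fun i => (PowerSeries.mk fun j => (ω ^ i) ^ j),
        ZMod.prod_val_eq_prod_range fun i => (PowerSeries.mk fun j => (ω ^ i) ^ j), hl]
    rw [Finset.sum_congr rfl fun ω hω => by rw [hc ω hω]]
    split_ifs with hkn
    · rw [Finset.sum_congr rfl fun ω hω => by
        rw [primitiveRoot_zpow_neg_genus (Nat.mul_div_cancel' hkn).symm hk0
          ((mem_primitiveRoots hk0).1 hω)]]
      rw [← Finset.sum_mul, ← Finset.mul_sum, sum_primitiveRoots_inv hk0]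
      ring
    · simp
  rw [Finset.sum_congr rfl h1, ← Finset.sum_filter] at h
  -- Only orders `k` dividing `n` survive; the sum is later reindexed by `d = n / k`.
  have h2 : (m * n).divisors.filter (· ∣ n) = n.divisors := by
    ext k
    simp only [Finset.mem_filter, Nat.mem_divisors]
    exact ⟨fun h => ⟨h.2, hn.ne'⟩, fun h => ⟨⟨h.1.mul_left m, hN.ne'⟩, h.1⟩⟩
  rw [h2, ← Finset.mul_sum] at h
  push_cast at h
  rw [mul_assoc] at h
  rw [mul_left_cancel₀ hm0 h, ← Nat.sum_div_divisors]
  refine Finset.sum_congr rfl fun k hk => ?_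
  rw [Nat.div_div_self (Nat.dvd_of_mem_divisors hk) hn.ne']

/-- The number of `S_n`-orbits of shift classes. -/
theorem card_permOrbits_dHat {m n : ℕ} (hm : 0 < m) (hn : 0 < n) :
    (Nat.card (PermOrbits n (DHat m n)) : ℚ) =
      1 / (n : ℚ) ^ 2 * ∑ d ∈ n.divisors, (-1 : ℚ) ^ (m * (n + d)) *
        (ArithmeticFunction.moebius (n / d) : ℚ) * (((m + 1) * d - 1).choose (m * d) : ℚ) := by
  have h := card_permOrbits_dSeq_formula hm hn
  rw [card_permOrbits_dSeq hm hn] at h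
  have hn0 : (n : ℚ) ≠ 0 := by exact_mod_cast hn.ne'
  have h' : (n : ℚ) * (n * Nat.card (PermOrbits n (DHat m n))) =
      ∑ d ∈ n.divisors, (-1 : ℚ) ^ (m * (n + d)) *
        (ArithmeticFunction.moebius (n / d) : ℚ) * (((m + 1) * d - 1).choose (m * d) : ℚ) := by
    exact_mod_cast h
  rw [← h']
  field_simp

/-! ### The Euler product of the tree series -/

/-- The sum is the `M`-th finite difference of `P` at `0`. -/
theorem sum_neg_one_pow_mul_choose_mul_eval {M : ℕ} {P : Polynomial ℚ} (hP : P.natDegree < M) :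
    ∑ k ∈ Finset.range (M + 1), (-1 : ℚ) ^ (M - k) * M.choose k * P.eval (k : ℚ) = 0 := by
  have h := congrFun (Polynomial.fwdDiff_iter_eq_zero_of_degree_lt hP) 0
  rw [fwdDiff_iter_eq_sum_shift] at h
  simpa using h

theorem treeSeries_coeff (m k : ℕ) :
    PowerSeries.coeff k (treeSeries m) =
      (m * k + k).factorial / ((m * k + 1).factorial * k.factorial) := by
  have h1 : ((m + 1) * k).choose k * (k.factorial * (m * k).factorial) = (m * k + k).factorial := by
    have := Nat.choose_mul_factorial_mul_factorial (n := m * k + k) (k := k) (by omega)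
    rw [Nat.add_sub_cancel] at this
    rw [add_mul, one_mul, ← this, mul_assoc]
  have h2 : (((m + 1) * k).choose k : ℚ) * (k.factorial * (m * k).factorial) =
      (m * k + k).factorial := by exact_mod_cast h1
  rw [treeSeries, PowerSeries.coeff_mk, ← h2, Nat.factorial_succ]
  have h3 : (k.factorial : ℚ) ≠ 0 := by exact_mod_cast k.factorial_ne_zero
  have h4 : ((m * k).factorial : ℚ) ≠ 0 := by exact_mod_cast (m * k).factorial_ne_zero
  have h5 : (m : ℚ) * k + 1 ≠ 0 := by positivity
  push_cast
  field_simp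

/-- After multiplication by `M!` the term at `k` is `(-1)^(M-k) binom(M, k) P(k)` with `P(x) =
(mx+2)⋯(mx+M)`, of degree below `M`, so the finite difference vanishes. -/
theorem sum_treeSeries_coeff_mul_choose (m : ℕ) {M : ℕ} (hM : 0 < M) :
    ∑ kj ∈ Finset.HasAntidiagonal.antidiagonal M, PowerSeries.coeff kj.1 (treeSeries m) *
      ((-1) ^ kj.2 * ((m * kj.1 + M).choose kj.2 : ℚ)) = 0 := by
  let P : Polynomial ℚ := ∏ i ∈ Finset.range (M - 1),
    (Polynomial.C (m : ℚ) * Polynomial.X + Polynomial.C ((i : ℚ) + 2))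
  have hP : P.natDegree < M := by
    refine lt_of_le_of_lt (Polynomial.natDegree_prod_le _ _) ?_
    refine lt_of_le_of_lt (Finset.sum_le_card_nsmul _ _ 1 fun i _ => ?_) ?_
    · exact Polynomial.natDegree_linear_le
    · simp
      omega
  have hPe : ∀ k : ℕ, P.eval (k : ℚ) * (m * k + 1).factorial = (m * k + M).factorial := by
    intro k
    obtain ⟨M, rfl⟩ : ∃ M', M = M' + 1 := ⟨M - 1, by omega⟩
    simp only [P, Polynomial.eval_prod, Nat.add_sub_cancel]
    clear hM P hP
    induction M with
    | zero => simp
    | succ M ih =>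
      rw [Finset.prod_range_succ, mul_right_comm, ih, ← add_assoc _ (M + 1) 1,
        Nat.factorial_succ (m * k + (M + 1))]
      simp
      ring
  have h := sum_neg_one_pow_mul_choose_mul_eval hP
  have hM0 : (M.factorial : ℚ) ≠ 0 := by exact_mod_cast M.factorial_ne_zero
  refine (mul_eq_zero.1 (?_ : (M.factorial : ℚ) * _ = 0)).resolve_left hM0
  rw [Finset.Nat.sum_antidiagonal_eq_sum_range_succ_mk, Finset.mul_sum, ← h]
  refine Finset.sum_congr rfl fun k hk => ?_
  have hkM : k ≤ M := Nat.lt_succ_iff.1 (Finset.mem_range.1 hk)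
  have hc1 : ((m * k + M).choose (M - k) : ℚ) =
      (m * k + M).factorial / ((M - k).factorial * (m * k + k).factorial) := by
    rw [Nat.cast_choose ℚ (by omega : M - k ≤ m * k + M)]
    congr 4
    omega
  rw [treeSeries_coeff, hc1, Nat.cast_choose ℚ hkM, ← hPe]
  have h1 : ((m * k + k).factorial : ℚ) ≠ 0 := by exact_mod_cast Nat.factorial_ne_zero _
  have h2 : ((m * k + 1).factorial : ℚ) ≠ 0 := by exact_mod_cast Nat.factorial_ne_zero _
  have h3 : (k.factorial : ℚ) ≠ 0 := by exact_mod_cast Nat.factorial_ne_zero _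
  have h4 : ((M - k).factorial : ℚ) ≠ 0 := by exact_mod_cast Nat.factorial_ne_zero _
  field_simp

/-- Chu–Vandermonde for `(m+1)l - 1 = (m+1)(k+l) - ((m+1)k+1)`, with the negative upper argument
reflected. The split makes the first factor depend on `k + l` only, so it stays fixed in the
convolution. -/
theorem choose_eq_sum_antidiagonal (m k l : ℕ) :
    (((m + 1) * l - 1).choose l : ℚ) = ∑ ij ∈ Finset.HasAntidiagonal.antidiagonal l,
      (((m + 1) * (k + l)).choose ij.1 : ℚ) *
        ((-1) ^ ij.2 * ((m * k + (k + ij.2)).choose ij.2 : ℚ)) := by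
  have h := Ring.add_choose_eq l
    (Commute.all (((m + 1) * (k + l) : ℕ) : ℤ) (-(((m + 1) * k + 1 : ℕ) : ℤ)))
  have h1 : Ring.choose ((((m + 1) * (k + l) : ℕ) : ℤ) + -(((m + 1) * k + 1 : ℕ) : ℤ)) l =
      (((m + 1) * l - 1).choose l : ℕ) := by
    rcases Nat.eq_zero_or_pos l with rfl | hl
    · simp
    · rw [← Ring.choose_natCast]
      congr 1
      have : 0 < (m + 1) * l := Nat.mul_pos (Nat.succ_pos m) hl
      push_cast [Nat.cast_sub (Nat.one_le_iff_ne_zero.2 this.ne')]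
      ring
  have h2 : ∀ j : ℕ, Ring.choose (-(((m + 1) * k + 1 : ℕ) : ℤ)) j =
      (-1) ^ j * ((m * k + (k + j)).choose j : ℕ) := by
    intro j
    rw [Ring.choose_neg, ← Ring.choose_natCast, Units.smul_def, Int.coe_negOnePow_natCast,
      smul_eq_mul]
    congr 2
    push_cast
    ring
  rw [h1] at h
  simp only [h2, Ring.choose_natCast] at h
  exact_mod_cast h

/-- A case of the Rothe-Hagen identity. -/
theorem sum_choose_mul_treeSeries_coeff (m n : ℕ) :
    ∑ kl ∈ Finset.HasAntidiagonal.antidiagonal n, PowerSeries.coeff kl.1 (treeSeries m) *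
      (((m + 1) * kl.2 - 1).choose kl.2 : ℚ) = (((m + 1) * n).choose n : ℚ) := by
  have h1 : ∀ kl ∈ Finset.HasAntidiagonal.antidiagonal n, PowerSeries.coeff kl.1 (treeSeries m) *
      (((m + 1) * kl.2 - 1).choose kl.2 : ℚ) = ∑ ij ∈ Finset.HasAntidiagonal.antidiagonal kl.2,
        PowerSeries.coeff kl.1 (treeSeries m) * ((((m + 1) * n).choose ij.1 : ℚ) *
        ((-1) ^ ij.2 * ((m * kl.1 + (kl.1 + ij.2)).choose ij.2 : ℚ))) := by
    intro kl hkl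
    rw [choose_eq_sum_antidiagonal m kl.1 kl.2, Finset.HasAntidiagonal.mem_antidiagonal.1 hkl, Finset.mul_sum]
  rw [Finset.sum_congr rfl h1]
  -- With `i` outermost, the inner sum over `k + j = r = n - i` is the vanishing sum above unless `r
  -- = 0`.
  have h2 : ∀ ir ∈ Finset.HasAntidiagonal.antidiagonal n,
      ∑ kj ∈ Finset.HasAntidiagonal.antidiagonal ir.2, PowerSeries.coeff kj.1 (treeSeries m) *
        ((((m + 1) * n).choose ir.1 : ℚ) *
          ((-1) ^ kj.2 * ((m * kj.1 + (kj.1 + kj.2)).choose kj.2 : ℚ))) =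
      if ir = (n, 0) then (((m + 1) * n).choose n : ℚ) else 0 := by
    rintro ⟨i, r⟩ hir
    rw [Finset.HasAntidiagonal.mem_antidiagonal] at hir
    rw [Finset.sum_congr rfl (g := fun kj => (((m + 1) * n).choose i : ℚ) *
      (PowerSeries.coeff kj.1 (treeSeries m) *
        ((-1) ^ kj.2 * ((m * kj.1 + r).choose kj.2 : ℚ)))), ← Finset.mul_sum]
    · rcases Nat.eq_zero_or_pos r with rfl | hr
      · obtain rfl : i = n := by simpa using hir
        simp [treeSeries]
      · rw [sum_treeSeries_coeff_mul_choose m hr, mul_zero, if_neg]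
        simp [hr.ne']
    · intro kj hkj
      rw [Finset.HasAntidiagonal.mem_antidiagonal.1 hkj]
      ring
  have h3 := Finset.sum_congr rfl h2
  rw [Finset.sum_ite_eq', if_pos (by simp)] at h3
  rw [← h3, Finset.sum_sigma', Finset.sum_sigma']
  -- The exchange of summations swaps the roles of `k` and `i` with `j` fixed, hence is given by the
  -- same formula in both directions.
  refine Finset.sum_nbij' (fun x => ⟨(x.2.1, x.1.1 + x.2.2), (x.1.1, x.2.2)⟩)
    (fun x => ⟨(x.2.1, x.1.1 + x.2.2), (x.1.1, x.2.2)⟩) ?_ ?_ ?_ ?_ ?_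
  · rintro ⟨⟨k, l⟩, ⟨i, j⟩⟩ h
    simp at h ⊢
    omega
  · rintro ⟨⟨k, l⟩, ⟨i, j⟩⟩ h
    simp at h ⊢
    omega
  · rintro ⟨⟨k, l⟩, ⟨i, j⟩⟩ h
    simp at h ⊢
    omega
  · rintro ⟨⟨k, l⟩, ⟨i, j⟩⟩ h
    simp at h ⊢
    omega
  · rintro ⟨⟨k, l⟩, ⟨i, j⟩⟩ h
    rfl

/-- The coefficients of the Euler derivative of the logarithm of the tree series. -/
def treeLogCoeff (m i : ℕ) : ℚ := if i = 0 then 0 else (((m + 1) * i - 1).choose (m * i) : ℚ)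

-- In the Rothe–Hagen sum, `binom((m+1)l-1, l)` is `m * treeLogCoeff m l` for `l > 0` and `1` for `l
-- = 0`. The latter term is `F_n`; subtracting it from `(mn+1) F_n` and dividing by `m` leaves `n
-- F_n = ∑ F_k * treeLogCoeff m l`.
open PowerSeries in
theorem X_mul_derivative_treeSeries {m : ℕ} (hm : 0 < m) :
    X * derivative ℚ (treeSeries m) = PowerSeries.mk (treeLogCoeff m) * treeSeries m := by
  ext n
  have h := sum_choose_mul_treeSeries_coeff m n
  have h1 : ∀ l : ℕ, (((m + 1) * l - 1).choose l : ℚ) =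
      (if l = 0 then 1 else 0) + m * treeLogCoeff m l := by
    intro l
    rcases Nat.eq_zero_or_pos l with rfl | hl
    · simp [treeLogCoeff]
    · have hml : 0 < m * l := Nat.mul_pos hm hl
      have h2 := choose_mul_eq m l hm hl
      have h3 : (m + 1) * l - 1 = m * l - 1 + l := by
        rw [add_mul, one_mul]
        omega
      rw [Nat.choose_symm_add, ← h3] at h2
      rw [h2, treeLogCoeff, if_neg hl.ne', if_neg hl.ne']
      push_cast
      ring
  have h0 : coeff n (treeSeries m) * ((m : ℚ) * n + 1) = (((m + 1) * n).choose n : ℚ) := by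
    have : (m : ℚ) * n + 1 ≠ 0 := by positivity
    rw [treeSeries, coeff_mk]
    field_simp
  have h4 : ∀ kl ∈ Finset.HasAntidiagonal.antidiagonal n, coeff kl.1 (treeSeries m) *
      (((m + 1) * kl.2 - 1).choose kl.2 : ℚ) =
      (if kl = (n, 0) then coeff n (treeSeries m) else 0) +
        m * (coeff kl.1 (treeSeries m) * treeLogCoeff m kl.2) := by
    rintro ⟨k, l⟩ hkl
    rw [Finset.HasAntidiagonal.mem_antidiagonal] at hkl
    rw [h1]
    by_cases hl : l = 0
    · subst hl
      obtain rfl : k = n := by simpa using hkl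
      simp
      ring
    · simp [hl]
      ring
  rw [Finset.sum_congr rfl h4, Finset.sum_add_distrib, Finset.sum_ite_eq', if_pos (by simp),
    ← Finset.mul_sum, ← h0] at h
  have h5 : coeff n (X * derivative ℚ (treeSeries m)) = n * coeff n (treeSeries m) := by
    rcases n with _ | n
    · simp
    · rw [coeff_succ_X_mul, coeff_derivative]
      push_cast
      ring
  rw [h5, mul_comm (PowerSeries.mk _), coeff_mul]
  simp only [coeff_mk]
  have hm0 : (m : ℚ) ≠ 0 := by exact_mod_cast hm.ne'
  refine mul_left_cancel₀ hm0 ?_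
  linear_combination -h

/-! ### Comparing power series through logarithmic derivatives -/

open PowerSeries in
theorem coeff_X_mul_derivative (P : PowerSeries ℚ) (n : ℕ) :
    coeff n (X * derivative ℚ P) = n * coeff n P := by
  rcases n with _ | n
  · simp
  · rw [coeff_succ_X_mul, coeff_derivative]
    push_cast
    ring

open PowerSeries in
/-- A power series is determined up to order `K` by the logarithmic derivative up to order `K`. -/
theorem coeff_eq_of_X_mul_derivative {P Q L M : PowerSeries ℚ} {K : ℕ}
    (hP : X * derivative ℚ P = L * P) (hQ : X * derivative ℚ Q = M * Q)
    (h0 : coeff 0 P = coeff 0 Q) (hL0 : coeff 0 L = 0)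
    (hLM : ∀ i ≤ K, coeff i L = coeff i M) (N : ℕ) (hN : N ≤ K) : coeff N P = coeff N Q := by
  induction N using Nat.strong_induction_on with
  | _ N ih =>
    rcases Nat.eq_zero_or_pos N with rfl | hpos
    · exact h0
    have h1 := coeff_X_mul_derivative P N
    have h2 := coeff_X_mul_derivative Q N
    rw [hP, coeff_mul] at h1
    rw [hQ, coeff_mul] at h2
    have h3 : ∀ p ∈ Finset.HasAntidiagonal.antidiagonal N,
        coeff p.1 L * coeff p.2 P = coeff p.1 M * coeff p.2 Q := by
      rintro ⟨i, j⟩ hp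
      rw [Finset.HasAntidiagonal.mem_antidiagonal] at hp
      simp only at hp ⊢
      rw [← hLM i (by omega)]
      rcases Nat.eq_zero_or_pos i with rfl | hi
      · rw [hL0, zero_mul, zero_mul]
      · rw [ih j (by omega) (by omega)]
    rw [Finset.sum_congr rfl h3, h2] at h1
    have : (N : ℚ) ≠ 0 := by exact_mod_cast hpos.ne'
    exact (mul_left_cancel₀ this h1).symm

open PowerSeries in
theorem one_add_X_mul_derivative_binomialSeries (r : ℚ) :
    (1 + X) * derivative ℚ (PowerSeries.binomialSeries ℚ r) = C r * PowerSeries.binomialSeries ℚ r := by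
  ext n
  have h : ∀ n : ℕ, coeff n (derivative ℚ (PowerSeries.binomialSeries ℚ r)) =
      (r - n) * Ring.choose r n := by
    intro n
    rw [coeff_derivative, binomialSeries_coeff, smul_eq_mul, mul_one]
    have := Ring.choose_smul_choose r (n := n + 1) (k := n) (by omega)
    simp at this
    rw [mul_comm, mul_comm (r - n), ← this]
  rw [add_mul, one_mul, map_add, h, coeff_C_mul, binomialSeries_coeff]
  rcases n with _ | n
  · simp
  · rw [coeff_succ_X_mul, h]
    have := h n
    rw [coeff_derivative, binomialSeries_coeff] at this
    simp at this ⊢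
    rw [← this]
    ring

-- For `u = -((-1)^m X)^k` and exponent `r`, the logarithmic derivative of `(1+u)^r` is `r k u /
-- (1+u)`, because `X u' = k u`. Its geometric expansion is the series displayed; the proof works
-- with denominators cleared and cancels `1 + u`, which has constant term `1`.
open PowerSeries in
theorem X_mul_derivative_eulerFactor (m : ℕ) {k : ℕ} (hk : 0 < k) (c : ℚ) :
    X * derivative ℚ (eulerFactor m k c) =
      PowerSeries.mk (fun N => if k ∣ N ∧ N ≠ 0 then (-1) ^ (m * (k + N)) * (k ^ 2 * c) else 0) *
        eulerFactor m k c := by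
  set r : ℚ := -((-1) ^ (m * k) * (k : ℚ) * c) with hr
  set u : PowerSeries ℚ := -(((-1) ^ m * X) ^ k) with hu
  set L : PowerSeries ℚ := PowerSeries.mk
    (fun N => if k ∣ N ∧ N ≠ 0 then (-1) ^ (m * (k + N)) * (k ^ 2 * c) else 0) with hL
  have hu' : u = C (-(-1) ^ (m * k)) * X ^ k := by
    rw [hu, mul_pow, ← pow_mul]
    simp
  have hcu : constantCoeff u = 0 := by
    rw [hu']
    simp [hk.ne']
  have hsub : HasSubst u := HasSubst.of_constantCoeff_zero' hcu
  have hdu : X * derivative ℚ u = (k : PowerSeries ℚ) * u := by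
    obtain ⟨k, rfl⟩ : ∃ k', k = k' + 1 := ⟨k - 1, by omega⟩
    rw [hu', Derivation.leibniz, Derivation.leibniz_pow]
    simp
    ring
  have h1 : (1 + u) * (derivative ℚ (PowerSeries.binomialSeries ℚ r)).subst u = C r * eulerFactor m k c := by
    have := congrArg (substAlgHom (R := ℚ) hsub) (one_add_X_mul_derivative_binomialSeries r)
    simp only [map_mul, map_add, map_one, substAlgHom_X] at this
    simp only [coe_substAlgHom, subst_C] at this
    exact this
  have h2 : (1 + u) * L = C r * (k : PowerSeries ℚ) * u := by
    have hone : ((-1 : ℚ) ^ (m * k)) * (-1) ^ (m * k) = 1 := by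
      rw [← mul_pow]
      simp
    have e1 : (1 + u) * L = L + C (-(-1) ^ (m * k)) * (X ^ k * L) := by
      rw [hu']
      ring
    have e2 : C r * (k : PowerSeries ℚ) * u = C (r * k * -(-1) ^ (m * k)) * X ^ k := by
      rw [hu', map_mul, map_mul, map_natCast]
      ring
    rw [e1, e2]
    ext N
    rw [map_add, coeff_C_mul, coeff_C_mul, coeff_X_pow_mul', coeff_X_pow, hL]
    simp only [coeff_mk]
    by_cases hkN : k ∣ N
    · obtain ⟨j, rfl⟩ := hkN
      rcases j with _ | _ | j
      · simp [hk.ne, hk.ne']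
      · simp [hk.ne', hr, mul_add, pow_add]
        ring
      · have h1 : k * (j + 1 + 1) - k = k * (j + 1) := by
          rw [mul_add k (j + 1), mul_one, Nat.add_sub_cancel]
        have h2 : k ≤ k * (j + 1 + 1) := Nat.le_mul_of_pos_right k (by omega)
        have h3 : k * (j + 1 + 1) ≠ k := by
          intro h
          have := Nat.eq_of_mul_eq_mul_left hk (h.trans (mul_one k).symm)
          omega
        rw [if_pos ⟨dvd_mul_right _ _, (hk.trans_le h2).ne'⟩, if_pos h2, if_neg h3, h1,
          if_pos ⟨dvd_mul_right _ _, (Nat.mul_pos hk (Nat.succ_pos j)).ne'⟩,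
          show m * (k + k * (j + 1 + 1)) = m * k + m * (k + k * (j + 1)) by ring, pow_add]
        ring
    · have h3 : N ≠ k := fun h => hkN (h ▸ dvd_rfl)
      have h4 : ∀ h : k ≤ N, ¬ k ∣ N - k := fun h h' =>
        hkN ((Nat.dvd_sub_iff_left h dvd_rfl).1 h')
      rw [if_neg (fun h => hkN h.1), if_neg h3]
      split_ifs with h5 h6
      · exact absurd h6.1 (h4 h5)
      · simp
      · simp
  have h3 : (1 + u) * (X * derivative ℚ (eulerFactor m k c)) =
      (1 + u) * (L * eulerFactor m k c) := by
    have h4 : derivative ℚ (eulerFactor m k c) =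
        (derivative ℚ (PowerSeries.binomialSeries ℚ r)).subst u * derivative ℚ u := derivative_subst hsub
    rw [h4]
    linear_combination X * derivative ℚ u * h1 + C r * eulerFactor m k c * hdu -
      eulerFactor m k c * h2
  refine mul_left_cancel₀ (fun h => ?_) h3
  have := congrArg constantCoeff h
  simp [hcu] at this

open PowerSeries in
theorem X_mul_derivative_prod {ι : Type*} (s : Finset ι) (E L : ι → PowerSeries ℚ)
    (h : ∀ k ∈ s, X * derivative ℚ (E k) = L k * E k) :
    X * derivative ℚ (∏ k ∈ s, E k) = (∑ k ∈ s, L k) * ∏ k ∈ s, E k := by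
  classical
  induction s using Finset.induction_on with
  | empty => simp
  | insert a s ha ih =>
    rw [Finset.prod_insert ha, Finset.sum_insert ha, Derivation.leibniz]
    have h1 := ih fun k hk => h k (Finset.mem_insert_of_mem hk)
    have h2 := h a (Finset.mem_insert_self a s)
    simp only [smul_eq_mul]
    linear_combination E a * h1 + (∏ k ∈ s, E k) * h2

/-- The explicit formula for the numerical Donaldson-Thomas invariants. -/
def dtFormula (m n : ℕ) : ℚ :=
  1 / (n : ℚ) ^ 2 * ∑ d ∈ n.divisors, (-1 : ℚ) ^ (m * (n + d)) *
    (ArithmeticFunction.moebius (n / d) : ℚ) * (((m + 1) * d - 1).choose (m * d) : ℚ)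

/-- Möbius inversion applied to `(-1)^(mk) k² dtFormula m k`; moving the sign `(-1)^(mn)` to the
other side costs nothing as it squares to `1`. -/
theorem sum_divisors_dtFormula (m : ℕ) {n : ℕ} (hn : 0 < n) :
    ∑ k ∈ n.divisors, (-1 : ℚ) ^ (m * (k + n)) * ((k : ℚ) ^ 2 * dtFormula m k) =
      (((m + 1) * n - 1).choose (m * n) : ℚ) := by
  have hsq : ∀ N : ℕ, (-1 : ℚ) ^ (m * N) * (-1) ^ (m * N) = 1 := fun N => by
    rw [← mul_pow]
    simp
  have h := (ArithmeticFunction.sum_eq_iff_sum_mul_moebius_eq (R := ℚ)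
    (f := fun k => (-1 : ℚ) ^ (m * k) * ((k : ℚ) ^ 2 * dtFormula m k))
    (g := fun k => (-1 : ℚ) ^ (m * k) * (((m + 1) * k - 1).choose (m * k) : ℚ))).2 (by
      intro N hN
      have hN0 : (N : ℚ) ≠ 0 := by exact_mod_cast hN.ne'
      rw [Nat.sum_divisorsAntidiagonal' fun a b => (ArithmeticFunction.moebius a : ℚ) *
          ((-1 : ℚ) ^ (m * b) * (((m + 1) * b - 1).choose (m * b) : ℚ)), dtFormula]
      field_simp
      rw [Finset.mul_sum]
      refine Finset.sum_congr rfl fun d _ => ?_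
      rw [mul_add, pow_add]
      linear_combination -((ArithmeticFunction.moebius (N / d) : ℚ) *
          ((-1 : ℚ) ^ (m * d) * (((m + 1) * d - 1).choose (m * d) : ℚ))) * hsq N) n hn
  have h' := congrArg (fun x => (-1 : ℚ) ^ (m * n) * x) h
  simp only [Finset.mul_sum] at h'
  rw [← mul_assoc, hsq, one_mul] at h'
  rw [← h']
  refine Finset.sum_congr rfl fun k _ => ?_
  rw [mul_add, pow_add]
  ring

open PowerSeries in
theorem isDTSequence_dtFormula {m : ℕ} (hm : 0 < m) : IsDTSequence m (dtFormula m) := by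
  intro N K hNK
  refine coeff_eq_of_X_mul_derivative (K := K)
    (X_mul_derivative_prod _ _ _ fun k hk =>
      X_mul_derivative_eulerFactor m (Finset.mem_Icc.1 hk).1 _)
    (X_mul_derivative_treeSeries hm) ?_ ?_ ?_ N hNK
  · rw [eulerProd_coeff_zero]
    simp [treeSeries]
  · rw [map_sum]
    exact Finset.sum_eq_zero fun k _ => by simp
  · intro i hi
    rw [map_sum]
    simp only [coeff_mk, treeLogCoeff]
    split_ifs with h0
    · simp [h0]
    -- For `0 < i ≤ K` every divisor of `i` lies in `Icc 1 K`, so the partial product already has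
    -- the full divisor sum as its coefficient.
    · rw [← sum_divisors_dtFormula m (Nat.pos_of_ne_zero h0), ← Finset.sum_filter]
      refine Finset.sum_congr ?_ fun _ _ => rfl
      ext k
      simp only [Finset.mem_filter, Finset.mem_Icc, Nat.mem_divisors]
      constructor
      · rintro ⟨-, h⟩
        exact h
      · intro h
        have h1 := Nat.le_of_dvd (Nat.pos_of_ne_zero h0) h.1
        have h2 := Nat.pos_of_dvd_of_pos h.1 (Nat.pos_of_ne_zero h0)
        exact ⟨⟨h2, by omega⟩, h⟩

theorem loopQuiverDT_eq_dtFormula {m n : ℕ} (hm : 0 < m) (hn : 0 < n) :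
    loopQuiverDT m n = dtFormula m n :=
  (loopQuiverDT_spec m).unique (isDTSequence_dtFormula hm) n hn

theorem theorem3p4 (m n : ℕ) (hm : 0 < m) (hn : 0 < n) :
    -- break divisors and shift classes: isomorphic as `S_n`-sets and as representations
    (∃ e : BreakDiv m n ≃ DHat m n,
      ∀ (σ : Equiv.Perm (Fin n)) (D : BreakDiv m n), e (σ • D) = σ • e D) ∧
    Nonempty (Representation.Equiv
      (Representation.ofMulAction ℂ (Equiv.Perm (Fin n)) (BreakDiv m n))
      (Representation.ofMulAction ℂ (Equiv.Perm (Fin n)) (DHat m n))) ∧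
    -- the number of orbits
    (Nat.card (MulAction.orbitRel.Quotient (Equiv.Perm (Fin n)) (BreakDiv m n)) : ℚ) =
      loopQuiverDT m n ∧
    (Nat.card (MulAction.orbitRel.Quotient (Equiv.Perm (Fin n)) (BreakDiv m n)) : ℚ) =
      1 / (n : ℚ) ^ 2 * ∑ d ∈ n.divisors, (-1 : ℚ) ^ (m * (n + d)) *
        (ArithmeticFunction.moebius (n / d) : ℚ) * (((m + 1) * d - 1).choose (m * d) : ℚ) ∧
    (Nat.card (MulAction.orbitRel.Quotient (Equiv.Perm (Fin n)) (DHat m n)) : ℚ) =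
      1 / (n : ℚ) ^ 2 * ∑ d ∈ n.divisors, (-1 : ℚ) ^ (m * (n + d)) *
        (ArithmeticFunction.moebius (n / d) : ℚ) * (((m + 1) * d - 1).choose (m * d) : ℚ) ∧
    -- restriction to the permutations fixing a vertex `q` gives the parking functions
    ∀ q : Fin n,
      (∃ e : BreakDiv m n ≃ Park m n q,
        ∀ (τ : Equiv.Perm {v : Fin n // v ≠ q}) (D : BreakDiv m n),
          e (Equiv.Perm.ofSubtype τ • D) = τ • e D) ∧
      Nonempty (Representation.Equiv
        ((Representation.ofMulAction ℂ (Equiv.Perm (Fin n)) (BreakDiv m n)).comp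
          (Equiv.Perm.ofSubtype (p := fun v : Fin n => v ≠ q)))
        (Representation.ofMulAction ℂ (Equiv.Perm {v : Fin n // v ≠ q}) (Park m n q))) := by
  let eB : BreakDiv m n ≃ DHat m n := Equiv.ofBijective _ (BreakDiv.toDHat_bijective hm hn)
  have heB : ∀ (σ : Equiv.Perm (Fin n)) (D : BreakDiv m n), eB (σ • D) = σ • eB D :=
    BreakDiv.toDHat_smul
  have hcard := card_permOrbits_congr eB heB
  have hformula := card_permOrbits_dHat hm hn
  refine ⟨⟨eB, heB⟩, nonempty_ofMulAction_equiv (MonoidHom.id _) eB heB, ?_, ?_, hformula,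
    fun q => ?_⟩
  · rw [loopQuiverDT_eq_dtFormula hm hn, dtFormula, ← hformula, hcard]
  · rw [← hformula, hcard]
  · let eP : Park m n q ≃ DHat m n := Equiv.ofBijective _ (Park.toDHat_bijective hm hn q)
    have heP : ∀ (τ : Equiv.Perm {v : Fin n // v ≠ q}) (f : Park m n q),
        eP (τ • f) = Equiv.Perm.ofSubtype τ • eP f := Park.toDHat_smul
    -- Only permutations fixing `q` are available here: the bijection with parking functions depends
    -- on the choice of `q`.
    have he : ∀ (τ : Equiv.Perm {v : Fin n // v ≠ q}) (D : BreakDiv m n),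
        (eB.trans eP.symm) (Equiv.Perm.ofSubtype τ • D) = τ • (eB.trans eP.symm) D := by
      intro τ D
      rw [Equiv.trans_apply, Equiv.symm_apply_eq, heP, heB, Equiv.trans_apply,
        Equiv.apply_symm_apply]
    exact ⟨⟨eB.trans eP.symm, he⟩,
      nonempty_ofMulAction_equiv (Equiv.Perm.ofSubtype (p := fun v : Fin n => v ≠ q)) _ he⟩
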